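/- Let $K:\mathbb R^d\to\mathbb R^m$ be linear with operator norm $L=\|K\|$, let $f:\mathbb R^m\to\mathbb R\cup\{\infty\}$ and $g:\mathbb R^d\to\mathbb R\cup\{\infty\}$ be convex, lower semicontinuous and not identically $\infty$, let $f^*(y)=\sup_x\{\langle x,y\rangle-f(x)\}$ and $\operatorname{prox}_{\gamma\varphi}=(\mathrm{id}+\gamma\,\partial\varphi)^{-1}$. For $\tau,\sigma,\theta>0$ and $(X^0,Y^0)\sim\pi_0$, $X_\theta^0=X^0$, consider, with i.i.d. $\xi^{n}\sim N(0,I_d)$ independent of $(X^0,Y^0)$, the modified unadjusted Langevin primal-dual algorithm (ULPDA) $$Y^{n+1}=\operatorname{prox}_{\sigma f^*}(Y^n+\sigma KX^n_\theta),\quad X^{n+1}=\operatorname{prox}_{\tau g}\bigl(X^n-\tau K^TY^{n+1}+\sqrt{2\tau}\,\xi^{n+1}\bigr),\quad X_\theta^{n+1}=X^{n+1}+\theta(X^{n+1}-X^n).$$ (The unmodified ULPDA has $X^{n+1}=\operatorname{prox}_{\tau g}(X^n-\tau K^TY^{n+1})+\sqrt{2\tau}\,\xi^{n+1}$ instead.)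 Let $\pi_n$ be the law of $(X^n,Y^n)$ and $\mu_n$ that of $X^n$; let $\tilde\pi_n,\tilde\mu_n$ be those for the initial law $\tilde\pi_0$. Let $\lambda=\sigma/\tau$, let $\mathcal W_2$ be the 2-Wasserstein distance and, for $a,b>0$, $$\mathcal T_{a,b}(\pi,\tilde\pi)=\inf_{M}\Bigl(\mathbb E_{((x,y),(\tilde x,\tilde y))\sim M}\bigl[a\|x-\tilde x\|^2+b\|y-\tilde y\|^2\bigr]\Bigr)^{1/2},$$ the infimum being over all couplings $M$ of $\pi$ and $\tilde\pi$. A probability measure on $\mathbb R^d\times\mathbb R^m$ is called stationary for the algorithm if it is the law of $(X,Y)$ for some invariant law of the Markov chain $(X^n,X^n_\theta,Y^n)$. Then the following hold. (1) If $\theta=1$ and $\tau\sigma L^2\le1$, then $\mathcal W_2(\mu_N,\tilde\mu_N)\le\mathcal T_{1,\lambda^{-1}}(\pi_0,\tilde\pi_0)$ for all $N\ge0$; and if $\tau\sigma L^2<1$, then $\mathcal T_{1,\lambda^{-1}}(\pi_N,\tilde\pi_N)\le(1-\tau\sigma L^2)^{-1/2}\,\mathcal T_{1,\lambda^{-1}}(\pi_0,\tilde\pi_0)$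 for all $N\ge0$. (2) Let $g$ and $f^*$ be $\omega_g$- and $\omega_{f^*}$-strongly convex with $\omega_g,\omega_{f^*}>0$, let $\max\{(1+2\omega_g\tau)^{-1},(1+2\omega_{f^*}\sigma)^{-1}\}\le\theta<1$ and $\theta\sigma\tau L^2\le1$, and put $\tilde\lambda=\frac{1+2\omega_g\tau}{1+2\omega_{f^*}\sigma}\lambda$. Then $\mathcal W_2(\mu_N,\tilde\mu_N)\le\theta^{N/2}\,\mathcal T_{1,\tilde\lambda^{-1}}(\pi_0,\tilde\pi_0)$ for all $N\ge0$. If $\theta\sigma\tau L^2<1$, then moreover $\mathcal T_{1,\tilde\lambda^{-1}}(\pi_N,\tilde\pi_N)\le(1-\theta\tau\sigma L^2)^{-1/2}\theta^{N/2}\,\mathcal T_{1,\tilde\lambda^{-1}}(\pi_0,\tilde\pi_0)$ for all $N\ge0$, and there is exactly one stationary distribution; it has finite second moment, and $\pi_N$ converges to it in $\mathcal T_{1,\tilde\lambda^{-1}}$ as $N\to\infty$ for every $\pi_0$ with finite second moment. (3) The stationary distribution may differ from that of the unmodified ULPDA: for all $d\ge1$, $m\ge0$, $K$, $\tau,\sigma,\omega_g,\omega_{f^*}>0$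 and $\theta$ that satisfy the conditions of (2) with $\theta\sigma\tau L^2<1$, there are $f,g$ as in (2) with $0<\int_{\mathbb R^d}e^{-f(Kx)-g(x)}\,dx<\infty$ such that each of the two algorithms has exactly one stationary distribution and these two distributions are different. -/

import Mathlib

open MeasureTheory ProbabilityTheory Filter Topology
open scoped ENNReal InnerProductSpace

noncomputable section

namespace ULPDA

section Convex

variable {E : Type*} [NormedAddCommGroup E] [InnerProductSpace ℝ E]

/-- `ω`-strong convexity of an extended-real-valued function (for functions that never take the
value `-∞`; the value `+∞` is allowed). For `ω = 0` this is convexity. -/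
def IsStronglyConvex (ω : ℝ) (φ : E → EReal) : Prop :=
  ∀ x y : E, ∀ a b : ℝ, 0 < a → 0 < b → a + b = 1 →
    φ (a • x + b • y) + ((ω / 2 * a * b * ‖x - y‖ ^ 2 : ℝ) : EReal)
      ≤ (a : EReal) * φ x + (b : EReal) * φ y

/-- Convexity of an extended-real-valued function. -/
def IsConvex (φ : E → EReal) : Prop :=
  ∀ x y : E, ∀ a b : ℝ, 0 < a → 0 < b → a + b = 1 →
    φ (a • x + b • y) ≤ (a : EReal) * φ x + (b : EReal) * φ y

/-- A potential term: a function with values in `ℝ ∪ {∞}`, not identically `∞`, convex and lower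
semicontinuous. -/
structure IsPotential (φ : E → EReal) : Prop where
  ne_bot : ∀ x, φ x ≠ ⊥
  proper : ∃ x, φ x ≠ ⊤
  convex : IsConvex φ
  lsc : LowerSemicontinuous φ

/-- The convex conjugate `f^*(y) = sup_x (⟨x, y⟩ - f x)`. -/
def conj (f : E → EReal) (y : E) : EReal :=
  ⨆ x : E, ((⟪x, y⟫_ℝ : ℝ) : EReal) - f x

/-- The subdifferential `∂φ(x)`. -/
def subdifferential (φ : E → EReal) (x : E) : Set E :=
  {p | ∀ y : E, φ x + ((⟪p, y - x⟫_ℝ : ℝ) : EReal) ≤ φ y}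

/-- The proximal mapping `prox_{γφ}(z) = (id + γ ∂φ)⁻¹(z)`: the (for a potential `φ` and `γ > 0`
unique) point `x` with `z ∈ x + γ ∂φ(x)`. -/
def prox (γ : ℝ) (φ : E → EReal) (z : E) : E :=
  Classical.epsilon fun x => ∃ p ∈ subdifferential φ x, z = x + γ • p

end Convex

section Transport

/-- The couplings of `μ` and `ν`. -/
def couplings {E : Type*} [MeasurableSpace E] (μ ν : Measure E) : Set (Measure (E × E)) :=
  {M | M.map Prod.fst = μ ∧ M.map Prod.snd = ν}

/-- The transport distance `inf_M (𝔼_{(x, x') ∼ M} |x - x'|²)^{1/2}` for a given norm `nrm`,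
with value `∞` if no coupling has finite cost. -/
def transportDist {E : Type*} [MeasurableSpace E] [AddGroup E] (nrm : E → ℝ)
    (μ ν : Measure E) : ℝ≥0∞ :=
  (⨅ M ∈ couplings μ ν, ∫⁻ p, ENNReal.ofReal (nrm (p.1 - p.2) ^ 2) ∂M) ^ (1 / 2 : ℝ)

/-- The 2-Wasserstein distance. -/
def W2 {E : Type*} [NormedAddCommGroup E] [MeasurableSpace E] (μ ν : Measure E) : ℝ≥0∞ :=
  transportDist (fun x : E => ‖x‖) μ ν

/-- The weighted norm `(a |x|² + b |y|²)^{1/2}` on a product space. -/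
def weightedNorm {E F : Type*} [NormedAddCommGroup E] [NormedAddCommGroup F] (a b : ℝ)
    (z : E × F) : ℝ :=
  Real.sqrt (a * ‖z.1‖ ^ 2 + b * ‖z.2‖ ^ 2)

/-- The transport distance `𝒯_{a,b}` induced by the weighted norm. -/
def T {E F : Type*} [NormedAddCommGroup E] [NormedAddCommGroup F] [MeasurableSpace E]
    [MeasurableSpace F] (a b : ℝ) (π ν : Measure (E × F)) : ℝ≥0∞ :=
  transportDist (weightedNorm a b) π ν

end Transport

section Algorithm

/-- The primal space `ℝ^d`. -/
abbrev Primal (d : ℕ) := EuclideanSpace ℝ (Fin d)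

/-- The dual space `ℝ^m`. -/
abbrev Dual (m : ℕ) := EuclideanSpace ℝ (Fin m)

variable {d m : ℕ}

/-- One iteration `(Xⁿ, X_θⁿ, Yⁿ) ↦ (Xⁿ⁺¹, X_θⁿ⁺¹, Yⁿ⁺¹)` of a primal-dual scheme in which
`primal v ξ` is the primal update at `v = Xⁿ - τ Kᵀ Yⁿ⁺¹` with noise `ξ`. -/
def pdStep (primal : Primal d → Primal d → Primal d) (f : Dual m → EReal)
    (K : Primal d →L[ℝ] Dual m) (τ σ θ : ℝ) (s : Primal d × Primal d × Dual m) (ξ : Primal d) :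
    Primal d × Primal d × Dual m :=
  let y := prox σ (conj f) (s.2.2 + σ • K s.2.1)
  let x := primal (s.1 - τ • (ContinuousLinearMap.adjoint K) y) ξ
  (x, x + θ • (x - s.1), y)

/-- The ULPDA iteration, with the noise added after the primal proximal map. -/
def ulpdaStep (f : Dual m → EReal) (g : Primal d → EReal) (K : Primal d →L[ℝ] Dual m)
    (τ σ θ : ℝ) : Primal d × Primal d × Dual m → Primal d → Primal d × Primal d × Dual m :=
  pdStep (fun v ξ => prox τ g v + Real.sqrt (2 * τ) • ξ) f K τ σ θ

/-- The modified iteration, with the noise added inside the primal proximal map. -/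
def modifiedStep (f : Dual m → EReal) (g : Primal d → EReal) (K : Primal d →L[ℝ] Dual m)
    (τ σ θ : ℝ) : Primal d × Primal d × Dual m → Primal d → Primal d × Primal d × Dual m :=
  pdStep (fun v ξ => prox τ g (v + Real.sqrt (2 * τ) • ξ)) f K τ σ θ

/-- The states `(Xⁿ, X_θⁿ, Yⁿ)` generated by an iteration from `z₀ = (X⁰, Y⁰)`, with `X_θ⁰ = X⁰`;
`ξ n` is the noise `ξⁿ⁺¹` used in the step from `n` to `n + 1`. -/
def states {Ω : Type*}
    (step : Primal d × Primal d × Dual m → Primal d → Primal d × Primal d × Dual m)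
    (z₀ : Ω → Primal d × Dual m) (ξ : ℕ → Ω → Primal d) :
    ℕ → Ω → Primal d × Primal d × Dual m
  | 0, w => ((z₀ w).1, (z₀ w).1, (z₀ w).2)
  | n + 1, w => step (states step z₀ ξ n w) (ξ n w)

/-- The iterates `(Xⁿ, Yⁿ)`. -/
def iterates {Ω : Type*}
    (step : Primal d × Primal d × Dual m → Primal d → Primal d × Primal d × Dual m)
    (z₀ : Ω → Primal d × Dual m) (ξ : ℕ → Ω → Primal d) (n : ℕ) (w : Ω) :
    Primal d × Dual m :=
  ((states step z₀ ξ n w).1, (states step z₀ ξ n w).2.2)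

/-- `z₀` is a random initial value and `ξ` an independent sequence of i.i.d. standard Gaussian
vectors. -/
structure IsInput {Ω : Type*} [MeasurableSpace Ω] (P : Measure Ω)
    (z₀ : Ω → Primal d × Dual m) (ξ : ℕ → Ω → Primal d) : Prop where
  measurable_init : Measurable z₀
  measurable_noise : ∀ n, Measurable (ξ n)
  noise_law : ∀ n, P.map (ξ n) = stdGaussian (Primal d)
  noise_indep : iIndepFun ξ P
  init_indep : IndepFun z₀ (fun w n => ξ n w) P

/-- `π` is a stationary distribution of the primal-dual variable `(Xⁿ, Yⁿ)`. As the Markov chain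
is formed by `(Xⁿ, X_θⁿ, Yⁿ)`, this means that `π` is the law of `(X, Y)` for some law of
`(X, X_θ, Y)` that is preserved by a step with independent Gaussian noise. -/
def IsStationaryLaw
    (step : Primal d × Primal d × Dual m → Primal d → Primal d × Primal d × Dual m)
    (π : Measure (Primal d × Dual m)) : Prop :=
  ∃ ρ : Measure (Primal d × Primal d × Dual m), IsProbabilityMeasure ρ ∧
    (ρ.prod (stdGaussian (Primal d))).map (fun p => step p.1 p.2) = ρ ∧
    ρ.map (fun s => (s.1, s.2.2)) = π

end Algorithm

end ULPDA

end

open ULPDA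

/-! Run two copies of the chain with the same noise. By the strong monotonicity of the two
subdifferentials, a quadratic energy of the difference of the two states, which couples its dual
part with `K` applied to its last primal increment, decreases by the factor `θ` in each step. By
Young's inequality and `θ σ τ ‖K‖² ≤ 1` the energy dominates a multiple of `‖x‖²`, and of
`‖(x, y)‖²` if the inequality is strict; this gives the transport bounds. If moreover `θ < 1`, then
the random maps contract geometrically for every choice of the noise, and the limit of the backward
iterates has the unique stationary law. For quadratic `f` and `g` the modified step is conjugate to
the unmodified one under the scaling by `c = (1 + τ ωg)⁻¹ < 1`. Equal stationary laws of `(X, Y)`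
would make the law of `X` invariant under this scaling, hence `X = 0` almost surely, which the
Gaussian noise excludes. -/

namespace ULPDA

open scoped NNReal

section ConvexAnalysis

variable {E : Type*} [NormedAddCommGroup E] [InnerProductSpace ℝ E] {φ : E → EReal} {ω γ : ℝ}

lemma IsPotential.exists_eq_coe (hφ : IsPotential φ) {x : E} (hx : φ x ≠ ⊤) :
    ∃ r : ℝ, φ x = r :=
  ⟨(φ x).toReal, (EReal.coe_toReal hx (hφ.ne_bot x)).symm⟩

lemma IsConvex.isStronglyConvex_zero (h : IsConvex φ) : IsStronglyConvex 0 φ := by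
  intro x y a b ha hb hab
  simpa using h x y a b ha hb hab

lemma ne_top_of_mem_subdifferential (hφ : ∃ x, φ x ≠ ⊤) {x p : E}
    (hp : p ∈ subdifferential φ x) : φ x ≠ ⊤ := by
  intro h
  obtain ⟨y, hy⟩ := hφ
  have hxy := hp y
  rw [h, EReal.top_add_coe] at hxy
  exact hy (top_le_iff.mp hxy)

lemma IsStronglyConvex.add_le_of_mem_subdifferential (hω : IsStronglyConvex ω φ) {x y p : E}
    {r s : ℝ} (hr : φ x = r) (hs : φ y = s) (hp : p ∈ subdifferential φ x) :
    r + ⟪p, y - x⟫_ℝ + ω / 2 * ‖x - y‖ ^ 2 ≤ s := by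
  have along_segment : ∀ a ∈ Set.Ioo (0 : ℝ) 1,
      r + ⟪p, y - x⟫_ℝ + a * (ω / 2 * ‖x - y‖ ^ 2) ≤ s := by
    intro a ⟨ha, ha1⟩
    have hconv := hω x y a (1 - a) ha (by linarith) (by ring)
    have hsub := hp (a • x + (1 - a) • y)
    rw [show a • x + (1 - a) • y - x = (1 - a) • (y - x) by module, real_inner_smul_right,
      hr] at hsub
    have h := (add_le_add_left hsub
      ((ω / 2 * a * (1 - a) * ‖x - y‖ ^ 2 : ℝ) : EReal)).trans hconv
    rw [hr, hs] at h
    norm_cast at h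
    exact le_of_mul_le_mul_left (by linarith :
      (1 - a) * (r + ⟪p, y - x⟫_ℝ + a * (ω / 2 * ‖x - y‖ ^ 2)) ≤ (1 - a) * s) (by linarith)
  have hlim : Tendsto (fun a : ℝ => r + ⟪p, y - x⟫_ℝ + a * (ω / 2 * ‖x - y‖ ^ 2)) (𝓝[<] 1)
      (𝓝 (r + ⟪p, y - x⟫_ℝ + 1 * (ω / 2 * ‖x - y‖ ^ 2))) :=
    ((continuous_const.add (continuous_id.mul continuous_const)).tendsto 1).mono_left
      nhdsWithin_le_nhds
  rw [one_mul] at hlim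
  exact le_of_tendsto hlim
    (mem_of_superset (Ioo_mem_nhdsLT (zero_lt_one' ℝ)) along_segment)

lemma IsPotential.subdifferential_monotone (hφ : IsPotential φ) (hω : IsStronglyConvex ω φ)
    {x y p q : E} (hp : p ∈ subdifferential φ x) (hq : q ∈ subdifferential φ y) :
    ω * ‖x - y‖ ^ 2 ≤ ⟪p - q, x - y⟫_ℝ := by
  obtain ⟨r, hr⟩ := hφ.exists_eq_coe (ne_top_of_mem_subdifferential hφ.proper hp)
  obtain ⟨s, hs⟩ := hφ.exists_eq_coe (ne_top_of_mem_subdifferential hφ.proper hq)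
  have h1 := hω.add_le_of_mem_subdifferential hr hs hp
  have h2 := hω.add_le_of_mem_subdifferential hs hr hq
  rw [norm_sub_rev y x] at h2
  rw [← neg_sub x y, inner_neg_right] at h1
  rw [inner_sub_left]
  linarith

lemma IsStronglyConvex.sub_inv_add_le (hω : IsStronglyConvex ω φ) (hω0 : 0 ≤ ω) {x₀ x : E}
    {r s t : ℝ} (hr : φ x₀ = r) (hs : φ x = s) (ht0 : 0 < t) (ht : t ≤ 1 / 2)
    (hle : ((r - 1 : ℝ) : EReal) ≤ φ ((1 - t) • x₀ + t • x)) :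
    r - t⁻¹ + ω / 4 * ‖x - x₀‖ ^ 2 ≤ s := by
  have h := (add_le_add_left hle ((ω / 2 * (1 - t) * t * ‖x₀ - x‖ ^ 2 : ℝ) : EReal)).trans
    (hω x₀ x (1 - t) t (by linarith) ht0 (by ring))
  rw [hr, hs, norm_sub_rev] at h
  norm_cast at h
  refine le_of_mul_le_mul_left ?_ ht0
  rw [mul_add, mul_sub, mul_inv_cancel₀ ht0.ne']
  have : 0 ≤ ω * t * ‖x - x₀‖ ^ 2 * (1 / 2 - t) := mul_nonneg (by positivity) (by linarith)
  linarith

lemma IsStronglyConvex.mul_norm_sub_sq_le (hω : IsStronglyConvex ω φ) {v ε : ℝ}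
    (hv : ∀ x, (v : EReal) ≤ φ x) {x y : E} (hx : φ x ≤ ((v + ε : ℝ) : EReal))
    (hy : φ y ≤ ((v + ε : ℝ) : EReal)) : ω * ‖x - y‖ ^ 2 ≤ 8 * ε := by
  have half_mul_le {a : EReal} (ha : a ≤ ((v + ε : ℝ) : EReal)) :
      ((1 / 2 : ℝ) : EReal) * a ≤ ((1 / 2 * (v + ε) : ℝ) : EReal) :=
    mul_le_mul_of_nonneg_left ha (EReal.coe_nonneg.mpr (by norm_num))
  have h := ((add_le_add_left (hv _) _).trans
    (hω x y (1 / 2) (1 / 2) (by norm_num) (by norm_num) (by norm_num))).trans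
      (add_le_add (half_mul_le hx) (half_mul_le hy))
  norm_cast at h
  linarith

lemma IsPotential.exists_forall_coe_le_of_isStronglyConvex (hφ : IsPotential φ) (hω0 : 0 < ω)
    (hω : IsStronglyConvex ω φ) : ∃ c : ℝ, ∀ x, (c : EReal) ≤ φ x := by
  obtain ⟨x₀, hx₀⟩ := hφ.proper
  obtain ⟨r, hr⟩ := hφ.exists_eq_coe hx₀
  obtain ⟨δ, hδ, hball⟩ := Metric.eventually_nhds_iff_ball.mp
    (hφ.lsc x₀ ((r - 1 : ℝ) : EReal)
      (by simpa only [hr] using EReal.coe_lt_coe_iff.mpr (sub_one_lt r)))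
  have hc : 0 ≤ 4 / (ω * δ ^ 2) := by positivity
  refine ⟨r - 1 - 4 / (ω * δ ^ 2), fun x => ?_⟩
  rcases lt_or_ge ‖x - x₀‖ δ with hx | hx
  · refine le_trans ?_ (hball x (mem_ball_iff_norm.mpr hx)).le
    exact_mod_cast (by linarith)
  by_cases hxt : φ x = ⊤
  · exact hxt ▸ le_top
  obtain ⟨s, hs⟩ := hφ.exists_eq_coe hxt
  set ρ := ‖x - x₀‖
  have hρ : 0 < ρ := hδ.trans_le hx
  obtain ⟨t, ht⟩ : ∃ t, t = δ / (2 * ρ) := ⟨_, rfl⟩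
  have htρ : t * ρ = δ / 2 := by rw [ht]; field_simp
  have ht0 : 0 < t := by rw [ht]; positivity
  have ht2 : t ≤ 1 / 2 := by nlinarith
  have hmem : (1 - t) • x₀ + t • x ∈ Metric.ball x₀ δ := by
    rw [mem_ball_iff_norm, show (1 - t) • x₀ + t • x - x₀ = t • (x - x₀) by module, norm_smul,
      Real.norm_of_nonneg ht0.le, htρ]
    linarith
  have hgrowth := hω.sub_inv_add_le hω0.le hr hs ht0 ht2 (hball _ hmem).le
  rw [hs]
  norm_cast
  have hsq : t⁻¹ - ω / 4 * ρ ^ 2 ≤ 4 / (ω * δ ^ 2) := by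
    have hdiff : 4 / (ω * δ ^ 2) - (t⁻¹ - ω / 4 * ρ ^ 2) = ω / 4 * (ρ - 4 / (ω * δ)) ^ 2 := by
      rw [ht]
      field_simp
      ring
    have : 0 ≤ ω / 4 * (ρ - 4 / (ω * δ)) ^ 2 := by positivity
    linarith
  linarith

/-- The sublevel sets above the infimum shrink to a point, by strong convexity at midpoints. -/
lemma IsPotential.exists_forall_le_of_isStronglyConvex [CompleteSpace E] (hφ : IsPotential φ)
    (hω0 : 0 < ω) (hω : IsStronglyConvex ω φ) : ∃ x, ∀ y, φ x ≤ φ y := by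
  obtain ⟨x₀, hx₀⟩ := hφ.proper
  obtain ⟨c, hc⟩ := hφ.exists_forall_coe_le_of_isStronglyConvex hω0 hω
  obtain ⟨v, hv⟩ : ∃ v : ℝ, ⨅ x, φ x = v :=
    ⟨_, (EReal.coe_toReal (ne_top_of_le_ne_top hx₀ (iInf_le φ x₀))
      (ne_bot_of_le_ne_bot (EReal.coe_ne_bot c) (le_iInf hc))).symm⟩
  have hv_le : ∀ x, (v : EReal) ≤ φ x := fun x => hv ▸ iInf_le φ x
  let sublevel (n : ℕ) : Set E := {x | φ x ≤ ((v + 1 / (n + 1) : ℝ) : EReal)}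
  have hne : ∀ n, (sublevel n).Nonempty := fun n => by
    obtain ⟨x, hx⟩ := iInf_lt_iff.mp (show ⨅ x, φ x < ((v + 1 / (n + 1) : ℝ) : EReal) by
      rw [hv]; exact_mod_cast lt_add_of_pos_right v Nat.one_div_pos_of_nat)
    exact ⟨x, hx.le⟩
  have hanti : Antitone sublevel := fun n k hnk x hx =>
    hx.trans (EReal.coe_le_coe_iff.mpr (add_le_add_right (Nat.one_div_le_one_div hnk) v))
  have hdist : ∀ n, ∀ x ∈ sublevel n, ∀ y ∈ sublevel n,
      dist x y ≤ Real.sqrt (8 / ω * (1 / (n + 1))) := by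
    intro n x hx y hy
    refine Real.le_sqrt_of_sq_le ?_
    rw [dist_eq_norm, div_mul_eq_mul_div, le_div_iff₀ hω0, mul_comm]
    exact hω.mul_norm_sub_sq_le hv_le hx hy
  obtain ⟨x, hx⟩ := Metric.nonempty_iInter_of_nonempty_biInter (s := sublevel)
    (fun n => hφ.lsc.isClosed_preimage _)
    (fun n => Metric.isBounded_iff.mpr ⟨_, fun x hx y hy => hdist n x hx y hy⟩)
    (fun n => (hne n).mono (Set.subset_iInter₂ fun k hk => hanti hk))
    (squeeze_zero (fun n => Metric.diam_nonneg)
      (fun n => Metric.diam_le_of_forall_dist_le (Real.sqrt_nonneg _) (hdist n))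
      (by simpa using (tendsto_one_div_add_atTop_nhds_zero_nat.const_mul (8 / ω)).sqrt))
  refine ⟨x, fun y => le_trans ?_ (hv_le y)⟩
  have hlim : Tendsto (fun n : ℕ => ((v + 1 / (n + 1) : ℝ) : EReal)) atTop (𝓝 v) := by
    refine (continuous_coe_real_ereal.tendsto v).comp ?_
    simpa using tendsto_one_div_add_atTop_nhds_zero_nat.const_add v
  exact ge_of_tendsto' hlim (Set.mem_iInter.mp hx)

end ConvexAnalysis

section Quadratic

variable {E : Type*} [NormedAddCommGroup E] {ω : ℝ}

/-- The potential `ω / 2 ‖x‖²`, with values in `EReal` as all potentials here. -/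
noncomputable def quadratic (ω : ℝ) (x : E) : EReal := ((ω / 2 * ‖x‖ ^ 2 : ℝ) : EReal)

lemma continuous_quadratic (ω : ℝ) : Continuous (quadratic ω : E → EReal) :=
  continuous_coe_real_ereal.comp (by fun_prop)

variable [InnerProductSpace ℝ E]

lemma norm_smul_add_smul_sq (x y : E) {a b : ℝ} (hab : a + b = 1) :
    ‖a • x + b • y‖ ^ 2 = a * ‖x‖ ^ 2 + b * ‖y‖ ^ 2 - a * b * ‖x - y‖ ^ 2 := by
  obtain rfl : b = 1 - a := by linarith
  rw [norm_add_sq_real, norm_sub_sq_real, norm_smul, norm_smul, mul_pow, mul_pow,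
    real_inner_smul_left, real_inner_smul_right, Real.norm_eq_abs, Real.norm_eq_abs, sq_abs,
    sq_abs]
  ring

lemma isStronglyConvex_quadratic (ω : ℝ) : IsStronglyConvex ω (quadratic ω : E → EReal) := by
  intro x y a b _ _ hab
  unfold quadratic
  norm_cast
  rw [norm_smul_add_smul_sq x y hab]
  exact le_of_eq (by ring)

lemma isPotential_quadratic (hω : 0 ≤ ω) : IsPotential (quadratic ω : E → EReal) where
  ne_bot _ := EReal.coe_ne_bot _
  proper := ⟨0, EReal.coe_ne_top _⟩
  convex x y a b ha hb hab :=
    (le_add_of_nonneg_right (EReal.coe_nonneg.mpr (by positivity))).trans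
      (isStronglyConvex_quadratic ω x y a b ha hb hab)
  lsc := (continuous_quadratic ω).lowerSemicontinuous

lemma smul_mem_subdifferential_quadratic (hω : 0 ≤ ω) (x : E) :
    ω • x ∈ subdifferential (quadratic ω) x := by
  intro y
  unfold quadratic
  norm_cast
  have hsq : 0 ≤ ω / 2 * ‖y - x‖ ^ 2 := by positivity
  rw [norm_sub_sq_real] at hsq
  rw [real_inner_smul_left, inner_sub_right, real_inner_self_eq_norm_sq, real_inner_comm]
  linarith

end Quadratic

section Prox

variable {E : Type*} [NormedAddCommGroup E] [InnerProductSpace ℝ E] {φ : E → EReal} {ω γ : ℝ}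

/-- The function `y ↦ φ y + ‖y - z‖² / (2 γ)`, whose minimizer is `prox γ φ z`. -/
noncomputable def proxObjective (γ : ℝ) (φ : E → EReal) (z y : E) : EReal :=
  φ y + quadratic γ⁻¹ (y - z)

lemma isStronglyConvex_proxObjective (hφ : IsConvex φ) (z : E) :
    IsStronglyConvex γ⁻¹ (proxObjective γ φ z) := by
  intro x y a b ha hb hab
  have hcomb : a • x + b • y - z = a • (x - z) + b • (y - z) := by
    nth_rw 1 [← one_smul ℝ z, ← hab]
    module
  have hquad := isStronglyConvex_quadratic γ⁻¹ (x - z) (y - z) a b ha hb hab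
  rw [sub_sub_sub_cancel_right, ← hcomb] at hquad
  refine (add_assoc _ _ _).trans_le ((add_le_add (hφ x y a b ha hb hab) hquad).trans_eq ?_)
  unfold proxObjective quadratic
  rw [EReal.left_distrib_of_nonneg_of_ne_top (EReal.coe_nonneg.mpr ha.le) (EReal.coe_ne_top a),
    EReal.left_distrib_of_nonneg_of_ne_top (EReal.coe_nonneg.mpr hb.le) (EReal.coe_ne_top b),
    add_add_add_comm]

lemma isPotential_proxObjective (hφ : IsPotential φ) (hγ : 0 < γ) (z : E) :
    IsPotential (proxObjective γ φ z) where
  ne_bot x := EReal.add_eq_bot_iff.not.mpr (not_or.mpr ⟨hφ.ne_bot x, EReal.coe_ne_bot _⟩)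
  proper := by
    obtain ⟨x, hx⟩ := hφ.proper
    exact ⟨x, EReal.add_ne_top hx (EReal.coe_ne_top _)⟩
  convex x y a b ha hb hab :=
    (le_add_of_nonneg_right (EReal.coe_nonneg.mpr (by positivity))).trans
      (isStronglyConvex_proxObjective hφ.convex z x y a b ha hb hab)
  lsc := hφ.lsc.add' ((continuous_quadratic γ⁻¹).comp
      (continuous_id.sub continuous_const)).lowerSemicontinuous
    fun x => EReal.continuousAt_add (Or.inr (EReal.coe_ne_bot _)) (Or.inl (hφ.ne_bot x))

lemma IsPotential.exists_resolvent [CompleteSpace E] (hφ : IsPotential φ) (hγ : 0 < γ) (z : E) :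
    ∃ x, ∃ p ∈ subdifferential φ x, z = x + γ • p := by
  have hΦ := isPotential_proxObjective hφ hγ z
  have hΦconv := isStronglyConvex_proxObjective (γ := γ) hφ.convex z
  obtain ⟨x, hmin⟩ := hΦ.exists_forall_le_of_isStronglyConvex (inv_pos.mpr hγ) hΦconv
  have hzero : (0 : E) ∈ subdifferential (proxObjective γ φ z) x := fun y => by
    simpa using hmin y
  obtain ⟨r, hr⟩ := hφ.exists_eq_coe (x := x) fun h =>
    ne_top_of_mem_subdifferential hΦ.proper hzero
      (by rw [proxObjective, h, quadratic, EReal.top_add_coe])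
  refine ⟨x, γ⁻¹ • (z - x), fun y => ?_, by rw [smul_inv_smul₀ hγ.ne']; abel⟩
  by_cases hyt : φ y = ⊤
  · exact hyt ▸ le_top
  obtain ⟨s, hs⟩ := hφ.exists_eq_coe hyt
  have h := hΦconv.add_le_of_mem_subdifferential (r := r + γ⁻¹ / 2 * ‖x - z‖ ^ 2)
    (s := s + γ⁻¹ / 2 * ‖y - z‖ ^ 2) (y := y) (by rw [proxObjective, hr, quadratic]; rfl)
    (by rw [proxObjective, hs, quadratic]; rfl) hzero
  rw [inner_zero_left, show y - z = (y - x) - (z - x) by abel, norm_sub_sq_real (y - x),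
    norm_sub_rev x z, norm_sub_rev x y, real_inner_comm] at h
  rw [hr, hs, real_inner_smul_left]
  norm_cast
  linarith

lemma IsPotential.prox_spec [CompleteSpace E] (hφ : IsPotential φ) (hγ : 0 < γ) (z : E) :
    ∃ p ∈ subdifferential φ (prox γ φ z), z = prox γ φ z + γ • p :=
  Classical.epsilon_spec (hφ.exists_resolvent hγ z)

lemma IsPotential.resolvent_monotone (hφ : IsPotential φ) (hω : IsStronglyConvex ω φ) (hγ : 0 ≤ γ)
    {x x' z z' : E} (h : ∃ p ∈ subdifferential φ x, z = x + γ • p)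
    (h' : ∃ p ∈ subdifferential φ x', z' = x' + γ • p) :
    γ * ω * ‖x - x'‖ ^ 2 ≤ ⟪(z - z') - (x - x'), x - x'⟫_ℝ := by
  obtain ⟨p, hp, rfl⟩ := h
  obtain ⟨q, hq, rfl⟩ := h'
  rw [show x + γ • p - (x' + γ • q) - (x - x') = γ • (p - q) by module, real_inner_smul_left,
    mul_assoc]
  exact mul_le_mul_of_nonneg_left (hφ.subdifferential_monotone hω hp hq) hγ

lemma IsPotential.prox_monotone [CompleteSpace E] (hφ : IsPotential φ)
    (hω : IsStronglyConvex ω φ) (hγ : 0 < γ) (z z' : E) :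
    γ * ω * ‖prox γ φ z - prox γ φ z'‖ ^ 2
      ≤ ⟪(z - z') - (prox γ φ z - prox γ φ z'), prox γ φ z - prox γ φ z'⟫_ℝ :=
  hφ.resolvent_monotone hω hγ.le (hφ.prox_spec hγ z) (hφ.prox_spec hγ z')

lemma norm_le_of_inner_sub_nonneg {u v : E} (h : 0 ≤ ⟪u - v, v⟫_ℝ) : ‖v‖ ≤ ‖u‖ := by
  rw [inner_sub_left, real_inner_self_eq_norm_sq] at h
  have hcs := real_inner_le_norm u v
  by_contra! huv
  nlinarith [norm_nonneg u, norm_nonneg v]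

lemma IsPotential.lipschitzWith_prox [CompleteSpace E] (hφ : IsPotential φ) (hγ : 0 < γ) :
    LipschitzWith 1 (prox γ φ) := by
  refine LipschitzWith.of_dist_le_mul fun z z' => ?_
  rw [NNReal.coe_one, one_mul, dist_eq_norm, dist_eq_norm]
  have h := hφ.prox_monotone hφ.convex.isStronglyConvex_zero hγ z z'
  exact norm_le_of_inner_sub_nonneg (by simpa only [mul_zero, zero_mul] using h)

lemma IsPotential.prox_eq [CompleteSpace E] (hφ : IsPotential φ) (hγ : 0 < γ) {x p : E}
    (hp : p ∈ subdifferential φ x) : prox γ φ (x + γ • p) = x := by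
  have h := hφ.resolvent_monotone hφ.convex.isStronglyConvex_zero hγ.le
    (hφ.prox_spec hγ (x + γ • p)) ⟨p, hp, rfl⟩
  rw [mul_zero, zero_mul] at h
  simpa [sub_eq_zero] using norm_le_of_inner_sub_nonneg h

lemma prox_quadratic [CompleteSpace E] (hω : 0 ≤ ω) (hγ : 0 < γ) (z : E) :
    prox γ (quadratic ω) z = (1 + γ * ω)⁻¹ • z := by
  have hpos : 1 + γ * ω ≠ 0 := by positivity
  have h := (isPotential_quadratic hω).prox_eq hγ
    (smul_mem_subdifferential_quadratic hω ((1 + γ * ω)⁻¹ • z))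
  rwa [smul_smul γ, ← one_smul ℝ ((1 + γ * ω)⁻¹ • z), smul_smul (γ * ω), mul_one, ← add_smul,
    smul_inv_smul₀ hpos, one_smul] at h

end Prox

section Conjugate

variable {E : Type*} [NormedAddCommGroup E] [InnerProductSpace ℝ E] {f : E → EReal}

lemma conj_le_iff {y : E} {c : EReal} :
    conj f y ≤ c ↔ ∀ x, ((⟪x, y⟫_ℝ : ℝ) : EReal) - f x ≤ c := iSup_le_iff

lemma le_conj (f : E → EReal) (x y : E) : ((⟪x, y⟫_ℝ : ℝ) : EReal) - f x ≤ conj f y :=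
  le_iSup (fun x => ((⟪x, y⟫_ℝ : ℝ) : EReal) - f x) x

lemma IsPotential.conj_ne_top_of_mem_subdifferential (hf : IsPotential f) {x p : E}
    (hp : p ∈ subdifferential f x) : conj f p ≠ ⊤ := by
  obtain ⟨r, hr⟩ := hf.exists_eq_coe (ne_top_of_mem_subdifferential hf.proper hp)
  refine ne_top_of_le_ne_top (EReal.coe_ne_top (⟪p, x⟫_ℝ - r)) (conj_le_iff.mpr fun y => ?_)
  by_cases hyt : f y = ⊤
  · rw [hyt, EReal.sub_top]
    exact bot_le
  obtain ⟨s, hs⟩ := hf.exists_eq_coe hyt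
  have h := hp y
  rw [hr, hs] at h
  rw [hs]
  norm_cast at h ⊢
  rw [inner_sub_right] at h
  rw [real_inner_comm]
  linarith

lemma IsPotential.conj [CompleteSpace E] (hf : IsPotential f) : IsPotential (conj f) where
  ne_bot y := by
    obtain ⟨x₀, hx₀⟩ := hf.proper
    obtain ⟨r, hr⟩ := hf.exists_eq_coe hx₀
    have h := le_conj f x₀ y
    rw [hr, ← EReal.coe_sub] at h
    exact ne_bot_of_le_ne_bot (EReal.coe_ne_bot _) h
  proper := by
    obtain ⟨x, p, hp, -⟩ := hf.exists_resolvent zero_lt_one 0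
    exact ⟨p, hf.conj_ne_top_of_mem_subdifferential hp⟩
  convex := by
    intro y y' a b ha hb hab
    refine conj_le_iff.mpr fun x => ?_
    by_cases hxt : f x = ⊤
    · rw [hxt, EReal.sub_top]
      exact bot_le
    obtain ⟨s, hs⟩ := hf.exists_eq_coe hxt
    have hy := mul_le_mul_of_nonneg_left (le_conj f x y) (EReal.coe_nonneg.mpr ha.le)
    have hy' := mul_le_mul_of_nonneg_left (le_conj f x y') (EReal.coe_nonneg.mpr hb.le)
    refine le_trans (le_of_eq ?_) (add_le_add hy hy')
    rw [hs, inner_add_right, real_inner_smul_right, real_inner_smul_right]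
    norm_cast
    linear_combination (-s) * hab.symm
  lsc := by
    refine lowerSemicontinuous_iSup fun x => ?_
    by_cases hxt : f x = ⊤
    · simp only [hxt, EReal.sub_top]
      exact lowerSemicontinuous_const
    obtain ⟨s, hs⟩ := hf.exists_eq_coe hxt
    simp only [hs, ← EReal.coe_sub]
    exact (continuous_coe_real_ereal.comp (by fun_prop)).lowerSemicontinuous

lemma conj_quadratic {ω : ℝ} (hω : 0 < ω) :
    conj (quadratic ω⁻¹ : E → EReal) = quadratic ω := by
  funext y
  refine le_antisymm (conj_le_iff.mpr fun x => ?_) ((le_of_eq ?_).trans (le_conj _ (ω • y) y))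
  · unfold quadratic
    norm_cast
    have hsq : 0 ≤ ω⁻¹ / 2 * ‖x - ω • y‖ ^ 2 := by positivity
    have hexp : ω⁻¹ / 2 * ‖x - ω • y‖ ^ 2
        = ω⁻¹ / 2 * ‖x‖ ^ 2 - ⟪x, y⟫_ℝ + ω / 2 * ‖y‖ ^ 2 := by
      rw [norm_sub_sq_real, real_inner_smul_right, norm_smul, Real.norm_of_nonneg hω.le]
      field_simp
    linarith
  · unfold quadratic
    norm_cast
    rw [real_inner_smul_left, real_inner_self_eq_norm_sq, norm_smul, Real.norm_of_nonneg hω.le]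
    field_simp
    ring

end Conjugate

section Energy

/-- The weight of a squared distance in the energy of a pair of states, for a step size `γ` and a
strong convexity modulus `ω`. -/
noncomputable def weight (γ ω : ℝ) : ℝ := (1 + 2 * ω * γ) / (2 * γ)

/-- The conditions on the step sizes `τ`, `σ`, the relaxation parameter `θ`, the strong convexity
moduli and the operator norm `L` under which the energy decreases. They cover both the convex case
(`θ = 1` and vanishing moduli) and the strongly convex one. -/
structure Admissible (τ σ θ ωg ωf L : ℝ) : Prop where
  tau_pos : 0 < τ
  sigma_pos : 0 < σ
  theta_pos : 0 < θ
  theta_le : θ ≤ 1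
  omega_g_nonneg : 0 ≤ ωg
  omega_f_nonneg : 0 ≤ ωf
  inv_g_le : (1 + 2 * ωg * τ)⁻¹ ≤ θ
  inv_f_le : (1 + 2 * ωf * σ)⁻¹ ≤ θ
  coupling_le : θ * σ * τ * L ^ 2 ≤ 1

lemma weight_pos {γ ω : ℝ} (hγ : 0 < γ) (hω : 0 ≤ ω) : 0 < weight γ ω := by
  unfold weight
  positivity

lemma one_div_le_mul_weight {γ ω θ : ℝ} (hγ : 0 < γ) (hω : 0 ≤ ω)
    (h : (1 + 2 * ω * γ)⁻¹ ≤ θ) : 1 / (2 * γ) ≤ θ * weight γ ω := by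
  rw [inv_le_iff_one_le_mul₀ (by positivity)] at h
  rw [weight, ← mul_div_assoc]
  gcongr

lemma weight_mul_norm_sq_le {E : Type*} [NormedAddCommGroup E] [InnerProductSpace ℝ E]
    {γ ω : ℝ} (hγ : 0 < γ) {p q w : E} (h : γ * ω * ‖p‖ ^ 2 ≤ ⟪(q + γ • w) - p, p⟫_ℝ) :
    weight γ ω * ‖p‖ ^ 2 ≤ 1 / (2 * γ) * ‖q‖ ^ 2 - ‖p - q‖ ^ 2 / (2 * γ) + ⟪w, p⟫_ℝ := by
  refine le_of_mul_le_mul_left ?_ hγ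
  rw [inner_sub_left, inner_add_left, real_inner_smul_left, real_inner_self_eq_norm_sq] at h
  have hweight : γ * (weight γ ω * ‖p‖ ^ 2) = γ * ω * ‖p‖ ^ 2 + ‖p‖ ^ 2 / 2 := by
    rw [weight]
    field_simp
    ring
  have hright : γ * (1 / (2 * γ) * ‖q‖ ^ 2 - ‖p - q‖ ^ 2 / (2 * γ) + ⟪w, p⟫_ℝ)
      = ⟪q, p⟫_ℝ + γ * ⟪w, p⟫_ℝ - ‖p‖ ^ 2 / 2 := by
    rw [norm_sub_sq_real, real_inner_comm]
    field_simp
    ring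
  linarith

variable {τ σ θ ωg ωf : ℝ}

lemma Admissible.half_tau_mul_le {L : ℝ} (h : Admissible τ σ θ ωg ωf L) :
    τ * L ^ 2 / 2 ≤ weight σ ωf * (θ * σ * τ * L ^ 2) := by
  have hσ := h.sigma_pos
  have hτ := h.tau_pos
  calc τ * L ^ 2 / 2 = 1 / (2 * σ) * (σ * (τ * L ^ 2)) := by field_simp
    _ ≤ θ * weight σ ωf * (σ * (τ * L ^ 2)) := by
      gcongr
      exact one_div_le_mul_weight hσ h.omega_f_nonneg h.inv_f_le
    _ = weight σ ωf * (θ * σ * τ * L ^ 2) := by ring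

lemma norm_sq_le_two_mul_of_increment {X Y : Type*} [NormedAddCommGroup X] [NormedSpace ℝ X]
    [NormedAddCommGroup Y] (hθ : 0 < θ) (hθ1 : θ ≤ 1) (s : X × X × Y) :
    ‖s‖ ^ 2 ≤ 2 * (‖s.1‖ ^ 2 + ‖s.2.2‖ ^ 2 + ‖θ⁻¹ • (s.2.1 - s.1)‖ ^ 2) := by
  set u := θ⁻¹ • (s.2.1 - s.1) with hu
  have hext : ‖s.2.1‖ ≤ ‖s.1‖ + ‖u‖ := calc
    ‖s.2.1‖ = ‖s.1 + θ • u‖ := by rw [hu, smul_inv_smul₀ hθ.ne', add_sub_cancel]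
    _ ≤ ‖s.1‖ + θ * ‖u‖ := by
      rw [← Real.norm_of_nonneg hθ.le, ← norm_smul, Real.norm_of_nonneg hθ.le]
      exact norm_add_le _ _
    _ ≤ ‖s.1‖ + ‖u‖ := by gcongr; exact mul_le_of_le_one_left (norm_nonneg _) hθ1
  have hext_sq : ‖s.2.1‖ ^ 2 ≤ 2 * (‖s.1‖ ^ 2 + ‖u‖ ^ 2) :=
    (by gcongr : ‖s.2.1‖ ^ 2 ≤ (‖s.1‖ + ‖u‖) ^ 2).trans add_sq_le
  have hx := sq_nonneg ‖s.1‖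
  have hy := sq_nonneg ‖s.2.2‖
  have hu := sq_nonneg ‖u‖
  rcases max_choice ‖s.1‖ ‖s.2‖ with hm | hm <;> rw [Prod.norm_def, hm]
  · linarith
  rcases max_choice ‖s.2.1‖ ‖s.2.2‖ with hm | hm <;> rw [Prod.norm_def, hm] <;> linarith

variable {X Y : Type*} [NormedAddCommGroup X] [InnerProductSpace ℝ X] [NormedAddCommGroup Y]
  [InnerProductSpace ℝ Y] {K : X →L[ℝ] Y}

/-- The quadratic form of the energy, where `x` and `y` are the differences of the primal and of
the dual variables of two runs and `u` is that of their last primal increments. -/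
noncomputable def energyForm (K : X →L[ℝ] Y) (τ σ ωg ωf : ℝ) (x u : X) (y : Y) : ℝ :=
  weight τ ωg * ‖x‖ ^ 2 + weight σ ωf * ‖y‖ ^ 2 + ⟪K u, y⟫_ℝ + ‖u‖ ^ 2 / (2 * τ)

/-- The energy of the difference `s` of two states `(Xⁿ, X_θⁿ, Yⁿ)`, from which the last increment
is recovered as `θ⁻¹ (X_θⁿ - Xⁿ)`. -/
noncomputable def energy (K : X →L[ℝ] Y) (τ σ θ ωg ωf : ℝ) (s : X × X × Y) : ℝ :=
  energyForm K τ σ ωg ωf s.1 (θ⁻¹ • (s.2.1 - s.1)) s.2.2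

lemma energy_diag (K : X →L[ℝ] Y) (τ σ θ ωg ωf : ℝ) (x : X) (y : Y) :
    energy K τ σ θ ωg ωf (x, x, y) = weight τ ωg * ‖x‖ ^ 2 + weight σ ωf * ‖y‖ ^ 2 := by
  simp [energy, energyForm]

lemma continuous_energy (K : X →L[ℝ] Y) (τ σ θ ωg ωf : ℝ) :
    Continuous (energy K τ σ θ ωg ωf) := by
  unfold energy energyForm
  fun_prop

lemma abs_inner_apply_le (K : X →L[ℝ] Y) (u : X) (y : Y) : |⟪K u, y⟫_ℝ| ≤ ‖K‖ * ‖u‖ * ‖y‖ :=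
  (abs_real_inner_le_norm _ _).trans
    (mul_le_mul_of_nonneg_right (K.le_opNorm u) (norm_nonneg y))

lemma Admissible.le_energyForm (h : Admissible τ σ θ ωg ωf ‖K‖) {e e' : ℝ} (he : 0 < e)
    (hee' : θ * σ * τ * ‖K‖ ^ 2 ≤ e * e') (x u : X) (y : Y) :
    weight τ ωg * ‖x‖ ^ 2 + (1 - e') * weight σ ωf * ‖y‖ ^ 2 + (1 - e) * (‖u‖ ^ 2 / (2 * τ))
      ≤ energyForm K τ σ ωg ωf x u y := by
  have hτ := h.tau_pos
  have hb := weight_pos h.sigma_pos h.omega_f_nonneg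
  have young : ‖K‖ * ‖u‖ * ‖y‖ ≤ e * (‖u‖ ^ 2 / (2 * τ)) + τ * ‖K‖ ^ 2 / 2 / e * ‖y‖ ^ 2 := by
    have hsq : e * (‖u‖ ^ 2 / (2 * τ)) + τ * ‖K‖ ^ 2 / 2 / e * ‖y‖ ^ 2 - ‖K‖ * ‖u‖ * ‖y‖
        = e / (2 * τ) * (‖u‖ - τ * ‖K‖ * ‖y‖ / e) ^ 2 := by
      field_simp
      ring
    have : 0 ≤ e / (2 * τ) * (‖u‖ - τ * ‖K‖ * ‖y‖ / e) ^ 2 := by positivity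
    linarith
  have hcoef : τ * ‖K‖ ^ 2 / 2 / e ≤ e' * weight σ ωf := by
    rw [div_le_iff₀ he]
    exact h.half_tau_mul_le.trans ((mul_le_mul_of_nonneg_left hee' hb.le).trans_eq (by ring))
  have hinner := (abs_le.mp (abs_inner_apply_le K u y)).1
  have hy := mul_le_mul_of_nonneg_right hcoef (sq_nonneg ‖y‖)
  unfold energyForm
  linarith

lemma Admissible.le_energy (h : Admissible τ σ θ ωg ωf ‖K‖) (s : X × X × Y) :
    weight τ ωg * ‖s.1‖ ^ 2 + (1 - θ * σ * τ * ‖K‖ ^ 2) * weight σ ωf * ‖s.2.2‖ ^ 2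
      ≤ energy K τ σ θ ωg ωf s := by
  have hform := h.le_energyForm (e := 1) one_pos (one_mul _).ge s.1 (θ⁻¹ • (s.2.1 - s.1)) s.2.2
  rwa [sub_self, zero_mul, add_zero] at hform

lemma Admissible.exists_norm_sq_le_energy (h : Admissible τ σ θ ωg ωf ‖K‖)
    (hlt : θ * σ * τ * ‖K‖ ^ 2 < 1) :
    ∃ c : ℝ, 0 < c ∧ ∀ s : X × X × Y, c * ‖s‖ ^ 2 ≤ energy K τ σ θ ωg ωf s := by
  have hτ := h.tau_pos
  have hσ := h.sigma_pos
  have hθ := h.theta_pos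
  have ha := weight_pos hτ h.omega_g_nonneg
  have hb := weight_pos hσ h.omega_f_nonneg
  set κ := θ * σ * τ * ‖K‖ ^ 2
  have : 0 ≤ κ := by positivity
  obtain ⟨e, he⟩ : ∃ e, e = (1 + κ) / 2 := ⟨_, rfl⟩
  have he0 : 0 < e := by rw [he]; positivity
  have he1 : 0 < 1 - e := by linarith
  have hee : κ ≤ e * e := by rw [he]; linarith [sq_nonneg (1 - κ)]
  set c := min (weight τ ωg) (min ((1 - e) * weight σ ωf) ((1 - e) / (2 * τ)))
  have hc : 0 < c := lt_min ha (lt_min (by positivity) (by positivity))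
  refine ⟨c / 2, half_pos hc, fun s => ?_⟩
  set u := θ⁻¹ • (s.2.1 - s.1)
  calc c / 2 * ‖s‖ ^ 2
      ≤ c / 2 * (2 * (‖s.1‖ ^ 2 + ‖s.2.2‖ ^ 2 + ‖u‖ ^ 2)) := by
        gcongr
        exact norm_sq_le_two_mul_of_increment hθ h.theta_le s
    _ = c * ‖s.1‖ ^ 2 + c * ‖s.2.2‖ ^ 2 + c * ‖u‖ ^ 2 := by ring
    _ ≤ weight τ ωg * ‖s.1‖ ^ 2 + (1 - e) * weight σ ωf * ‖s.2.2‖ ^ 2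
          + (1 - e) / (2 * τ) * ‖u‖ ^ 2 := by
        gcongr
        exacts [min_le_left _ _, (min_le_right _ _).trans (min_le_left _ _),
          (min_le_right _ _).trans (min_le_right _ _)]
    _ ≤ energy K τ σ θ ωg ωf s := by
        rw [div_mul_eq_mul_div, mul_div_assoc]
        exact h.le_energyForm he0 hee _ _ _

lemma Admissible.exists_energy_le (h : Admissible τ σ θ ωg ωf ‖K‖) :
    ∃ C : ℝ, 0 < C ∧ ∀ s : X × X × Y, energy K τ σ θ ωg ωf s ≤ C * ‖s‖ ^ 2 := by
  have hτ := h.tau_pos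
  have hθ := h.theta_pos
  have ha := weight_pos hτ h.omega_g_nonneg
  have hb := weight_pos h.sigma_pos h.omega_f_nonneg
  refine ⟨weight τ ωg + weight σ ωf + ‖K‖ * (θ⁻¹ * 2) + (θ⁻¹ * 2) ^ 2 / (2 * τ),
    by positivity, fun s => ?_⟩
  have hx : ‖s.1‖ ≤ ‖s‖ := norm_fst_le s
  have hy : ‖s.2.2‖ ≤ ‖s‖ := (norm_snd_le s.2).trans (norm_snd_le s)
  have hu : ‖θ⁻¹ • (s.2.1 - s.1)‖ ≤ θ⁻¹ * 2 * ‖s‖ := by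
    rw [norm_smul, norm_inv, Real.norm_of_nonneg hθ.le, mul_assoc]
    gcongr
    linarith [norm_sub_le s.2.1 s.1, (norm_fst_le s.2).trans (norm_snd_le s)]
  calc energy K τ σ θ ωg ωf s
      ≤ weight τ ωg * ‖s‖ ^ 2 + weight σ ωf * ‖s‖ ^ 2 + ‖K‖ * (θ⁻¹ * 2 * ‖s‖) * ‖s‖
          + (θ⁻¹ * 2 * ‖s‖) ^ 2 / (2 * τ) := by
        unfold energy energyForm
        gcongr
        exact ((le_abs_self _).trans (abs_inner_apply_le _ _ _)).trans (by gcongr)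
    _ = _ := by ring

lemma Admissible.mul_inner_le (h : Admissible τ σ θ ωg ωf ‖K‖) (u : X) (v : Y) :
    θ * ⟪K u, v⟫_ℝ ≤ ‖v‖ ^ 2 / (2 * σ) + θ * (‖u‖ ^ 2 / (2 * τ)) := by
  have hτ := h.tau_pos
  have hσ := h.sigma_pos
  have hθ := h.theta_pos
  have hinner := mul_le_mul_of_nonneg_left (abs_le.mp (abs_inner_apply_le K u v)).2 hθ.le
  have young : ‖v‖ ^ 2 / (2 * σ) + θ * σ * τ * ‖K‖ ^ 2 * (θ * (‖u‖ ^ 2 / (2 * τ)))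
      - θ * (‖K‖ * ‖u‖ * ‖v‖) = (‖v‖ - σ * θ * ‖K‖ * ‖u‖) ^ 2 / (2 * σ) := by
    field_simp
    ring
  have : 0 ≤ (‖v‖ - σ * θ * ‖K‖ * ‖u‖) ^ 2 / (2 * σ) := by positivity
  have hcoupling := mul_le_mul_of_nonneg_right h.coupling_le
    (by positivity : 0 ≤ θ * (‖u‖ ^ 2 / (2 * τ)))
  linarith

lemma Admissible.energyForm_le_mul [CompleteSpace X] [CompleteSpace Y]
    (h : Admissible τ σ θ ωg ωf ‖K‖) {x u x' : X} {y y' : Y}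
    (hy : σ * ωf * ‖y'‖ ^ 2 ≤ ⟪(y + σ • K (x + θ • u)) - y', y'⟫_ℝ)
    (hx : τ * ωg * ‖x'‖ ^ 2 ≤ ⟪(x - τ • (ContinuousLinearMap.adjoint K) y') - x', x'⟫_ℝ) :
    energyForm K τ σ ωg ωf x' (x' - x) y' ≤ θ * energyForm K τ σ ωg ωf x u y := by
  rw [sub_eq_add_neg x, ← smul_neg] at hx
  have hdual := weight_mul_norm_sq_le h.sigma_pos hy
  have hprimal := weight_mul_norm_sq_le h.tau_pos hx
  rw [inner_neg_left, ContinuousLinearMap.adjoint_inner_left, real_inner_comm] at hprimal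
  rw [map_add, map_smul, inner_add_left, real_inner_smul_left] at hdual
  have hcross := h.mul_inner_le u (y' - y)
  rw [inner_sub_right] at hcross
  have hwx := mul_le_mul_of_nonneg_right
    (one_div_le_mul_weight h.tau_pos h.omega_g_nonneg h.inv_g_le) (sq_nonneg ‖x‖)
  have hwy := mul_le_mul_of_nonneg_right
    (one_div_le_mul_weight h.sigma_pos h.omega_f_nonneg h.inv_f_le) (sq_nonneg ‖y‖)
  unfold energyForm
  rw [map_sub, inner_sub_left]
  linarith

end Energy

section RandomIteration

variable {S S' E : Type*} [MeasurableSpace S] [MeasurableSpace S'] [MeasurableSpace E]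
  {F : S → E → S} {γ : Measure E}

/-- The law of `F s e` for independent `s ∼ μ` and `e ∼ γ`: one step of the Markov chain driven by
the random map `F` with noise law `γ`. -/
noncomputable def stepLaw (F : S → E → S) (γ : Measure E) (μ : Measure S) : Measure S :=
  (μ.prod γ).map fun p => F p.1 p.2

lemma isFiniteMeasure_stepLaw [IsProbabilityMeasure γ] (μ : Measure S) [IsFiniteMeasure μ] :
    IsFiniteMeasure (stepLaw F γ μ) :=
  Measure.isFiniteMeasure_map _ _

lemma stepLaw_map {G : S' → E → S'} {h : S → S'} [SFinite γ]
    (hF : Measurable fun p : S × E => F p.1 p.2) (hG : Measurable fun p : S' × E => G p.1 p.2)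
    (hh : Measurable h) (hsemi : ∀ s e, h (F s e) = G (h s) e) (μ : Measure S) [SFinite μ] :
    stepLaw G γ (μ.map h) = (stepLaw F γ μ).map h := by
  have hprod : (μ.map h).prod γ = (μ.prod γ).map (Prod.map h id) :=
    ((hh.measurePreserving μ).prod (MeasurePreserving.id γ)).map_eq.symm
  unfold stepLaw
  rw [hprod, Measure.map_map hG (by fun_prop), Measure.map_map hh hF]
  congr 1
  ext p
  exact (hsemi p.1 p.2).symm

lemma stepLaw_iterate_map {G : S' → E → S'} {h : S → S'} [IsProbabilityMeasure γ]
    (hF : Measurable fun p : S × E => F p.1 p.2) (hG : Measurable fun p : S' × E => G p.1 p.2)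
    (hh : Measurable h) (hsemi : ∀ s e, h (F s e) = G (h s) e) (n : ℕ) (μ : Measure S)
    [IsFiniteMeasure μ] :
    (stepLaw G γ)^[n] (μ.map h) = ((stepLaw F γ)^[n] μ).map h := by
  induction n generalizing μ with
  | zero => rfl
  | succ n ih =>
    have := isFiniteMeasure_stepLaw (F := F) (γ := γ) μ
    rw [Function.iterate_succ_apply, Function.iterate_succ_apply, stepLaw_map hF hG hh hsemi, ih]

/-- Two copies of the random map `F` driven by the same noise. -/
def synchronousStep (F : S → E → S) (p : S × S) (e : E) : S × S :=
  (F p.1 e, F p.2 e)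

lemma measurable_synchronousStep (hF : Measurable fun p : S × E => F p.1 p.2) :
    Measurable fun p : (S × S) × E => synchronousStep F p.1 p.2 :=
  (hF.comp (by fun_prop : Measurable fun p : (S × S) × E => (p.1.1, p.2))).prodMk
    (hF.comp (by fun_prop : Measurable fun p : (S × S) × E => (p.1.2, p.2)))

lemma synchronousStep_iterate_mem_couplings [IsProbabilityMeasure γ]
    (hF : Measurable fun p : S × E => F p.1 p.2) {μ μ' : Measure S} {M : Measure (S × S)}
    [IsFiniteMeasure M] (hM : M ∈ couplings μ μ') (n : ℕ) :
    (stepLaw (synchronousStep F) γ)^[n] M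
      ∈ couplings ((stepLaw F γ)^[n] μ) ((stepLaw F γ)^[n] μ') := by
  have hFF := measurable_synchronousStep hF
  rw [← hM.1, ← hM.2]
  exact ⟨(stepLaw_iterate_map hFF hF measurable_fst (fun _ _ => rfl) n M).symm,
    (stepLaw_iterate_map hFF hF measurable_snd (fun _ _ => rfl) n M).symm⟩

lemma lintegral_stepLaw_iterate_le [IsProbabilityMeasure γ]
    (hF : Measurable fun p : S × E => F p.1 p.2) {W : S → ℝ≥0∞} (hW : Measurable W) {q : ℝ≥0∞}
    (hle : ∀ s e, W (F s e) ≤ q * W s) (n : ℕ) (μ : Measure S) :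
    ∫⁻ s, W s ∂(stepLaw F γ)^[n] μ ≤ q ^ n * ∫⁻ s, W s ∂μ := by
  induction n with
  | zero => simp
  | succ n ih =>
    rw [Function.iterate_succ_apply', pow_succ', mul_assoc]
    calc ∫⁻ s, W s ∂stepLaw F γ ((stepLaw F γ)^[n] μ)
        = ∫⁻ p, W (F p.1 p.2) ∂((stepLaw F γ)^[n] μ).prod γ := lintegral_map hW hF
      _ ≤ ∫⁻ p, q * W p.1 ∂((stepLaw F γ)^[n] μ).prod γ := lintegral_mono fun p => hle p.1 p.2
      _ = q * ∫⁻ p, W p.1 ∂((stepLaw F γ)^[n] μ).prod γ :=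
        lintegral_const_mul q (hW.comp measurable_fst)
      _ = q * ∫⁻ s, W s ∂(stepLaw F γ)^[n] μ := by
        rw [measurePreserving_fst.lintegral_comp hW]
      _ ≤ q * (q ^ n * ∫⁻ s, W s ∂μ) := by gcongr

end RandomIteration

section Transport

variable {A B S E : Type*} [MeasurableSpace A] [MeasurableSpace B] [MeasurableSpace S]
  [MeasurableSpace E]

lemma isFiniteMeasure_of_mem_couplings {μ μ' : Measure A} [IsFiniteMeasure μ]
    {M : Measure (A × A)} (hM : M ∈ couplings μ μ') : IsFiniteMeasure M := by
  refine ⟨?_⟩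
  rw [← Set.preimage_univ (f := Prod.fst), ← Measure.map_apply measurable_fst .univ, hM.1]
  exact measure_lt_top μ Set.univ

lemma map_prodMap_mem_couplings {h : A → B} (hh : Measurable h) {μ μ' : Measure A}
    {M : Measure (A × A)} (hM : M ∈ couplings μ μ') :
    M.map (Prod.map h h) ∈ couplings (μ.map h) (μ'.map h) := by
  have hhh : Measurable (Prod.map h h) := hh.prodMap hh
  refine ⟨?_, ?_⟩
  · rw [Measure.map_map measurable_fst hhh, ← hM.1, Measure.map_map hh measurable_fst]
    rfl
  · rw [Measure.map_map measurable_snd hhh, ← hM.2, Measure.map_map hh measurable_snd]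
    rfl

lemma transportDist_le_mul_of_couplings [AddGroup A] [AddGroup B] {nrmA : A → ℝ} {nrmB : B → ℝ}
    {μ μ' : Measure A} {ν ν' : Measure B} {k : ℝ≥0∞} (hk₀ : k ≠ 0) (hk : k ≠ ∞)
    (h : ∀ M ∈ couplings μ μ', ∃ M' ∈ couplings ν ν',
      ∫⁻ p, ENNReal.ofReal (nrmB (p.1 - p.2) ^ 2) ∂M'
        ≤ k * ∫⁻ p, ENNReal.ofReal (nrmA (p.1 - p.2) ^ 2) ∂M) :
    transportDist nrmB ν ν' ≤ k ^ (1 / 2 : ℝ) * transportDist nrmA μ μ' := by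
  unfold transportDist
  rw [← ENNReal.mul_rpow_of_nonneg _ _ (by norm_num)]
  simp only [ENNReal.mul_iInf_of_ne hk₀ hk]
  gcongr
  refine le_iInf₂ fun M hM => ?_
  obtain ⟨M', hM', hle⟩ := h M hM
  exact (iInf₂_le M' hM').trans hle

/-- Running two copies of the chain with the same noise turns every coupling of the initial laws
into a coupling of the laws after `n` steps. -/
lemma transportDist_stepLaw_iterate_le [AddGroup A] [AddGroup B] {nrmA : A → ℝ} {nrmB : B → ℝ}
    {F : S → E → S} {γ : Measure E} [IsProbabilityMeasure γ] {init : A → S} {proj : S → B}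
    (hF : Measurable fun p : S × E => F p.1 p.2) (hinit : Measurable init)
    (hproj : Measurable proj) (hcost : Measurable fun p : B × B => nrmB (p.1 - p.2))
    {W : S × S → ℝ≥0∞} (hW : Measurable W) {c q : ℝ≥0∞} (hc₀ : c ≠ 0) (hc : c ≠ ∞)
    (hq₀ : q ≠ 0) (hq : q ≠ ∞)
    (hin : ∀ a a', W (init a, init a') ≤ c * ENNReal.ofReal (nrmA (a - a') ^ 2))
    (hstep : ∀ s s' e, W (F s e, F s' e) ≤ q * W (s, s'))
    (hout : ∀ s s', ENNReal.ofReal (nrmB (proj s - proj s') ^ 2) ≤ W (s, s'))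
    (n : ℕ) (μ μ' : Measure A) [IsFiniteMeasure μ] :
    transportDist nrmB (((stepLaw F γ)^[n] (μ.map init)).map proj)
        (((stepLaw F γ)^[n] (μ'.map init)).map proj)
      ≤ (q ^ n * c) ^ (1 / 2 : ℝ) * transportDist nrmA μ μ' := by
  refine transportDist_le_mul_of_couplings (mul_ne_zero (pow_ne_zero n hq₀) hc₀)
    (ENNReal.mul_ne_top (ENNReal.pow_ne_top hq) hc) fun M hM => ?_
  have := isFiniteMeasure_of_mem_couplings hM
  refine ⟨_, map_prodMap_mem_couplings hproj
    (synchronousStep_iterate_mem_couplings (γ := γ) hF (map_prodMap_mem_couplings hinit hM) n), ?_⟩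
  set Mₙ := (stepLaw (synchronousStep F) γ)^[n] (M.map (Prod.map init init))
  calc ∫⁻ p, ENNReal.ofReal (nrmB (p.1 - p.2) ^ 2) ∂Mₙ.map (Prod.map proj proj)
      = ∫⁻ p, ENNReal.ofReal (nrmB (proj p.1 - proj p.2) ^ 2) ∂Mₙ :=
        lintegral_map (hcost.pow_const 2).ennreal_ofReal (hproj.prodMap hproj)
    _ ≤ ∫⁻ p, W p ∂Mₙ := lintegral_mono fun p => hout p.1 p.2
    _ ≤ q ^ n * ∫⁻ p, W p ∂M.map (Prod.map init init) :=
        lintegral_stepLaw_iterate_le (measurable_synchronousStep hF) hW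
          (fun p e => hstep p.1 p.2 e) n _
    _ = q ^ n * ∫⁻ p, W (init p.1, init p.2) ∂M := by
        rw [lintegral_map hW (hinit.prodMap hinit)]
        rfl
    _ ≤ q ^ n * ∫⁻ p, c * ENNReal.ofReal (nrmA (p.1 - p.2) ^ 2) ∂M := by
        gcongr with p
        exact hin p.1 p.2
    _ = q ^ n * c * ∫⁻ p, ENNReal.ofReal (nrmA (p.1 - p.2) ^ 2) ∂M := by
        rw [lintegral_const_mul' c _ hc, mul_assoc]

end Transport

section IteratedRandomMaps

variable {S E : Type*} {F : S → E → S}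

/-- The state after `n` steps of `F` from `s`, with the noise `ξ 0, …, ξ (n - 1)` used in this
order. -/
def forwardIter (F : S → E → S) : ℕ → S → (ℕ → E) → S
  | 0, s, _ => s
  | n + 1, s, ξ => forwardIter F n (F s (ξ 0)) fun k => ξ (k + 1)

/-- The state after `n` steps of `F` from `s`, with the noise `ξ (n - 1), …, ξ 0` used in this
order: it has the same law as `forwardIter` but converges pathwise for a contracting `F`. -/
def backwardIter (F : S → E → S) : ℕ → S → (ℕ → E) → S
  | 0, s, _ => s
  | n + 1, s, ξ => F (backwardIter F n s fun k => ξ (k + 1)) (ξ 0)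

lemma forwardIter_succ' (n : ℕ) (s : S) (ξ : ℕ → E) :
    forwardIter F (n + 1) s ξ = F (forwardIter F n s ξ) (ξ n) := by
  induction n generalizing s ξ with
  | zero => rfl
  | succ _ ih => exact ih (F s (ξ 0)) fun k => ξ (k + 1)

lemma backwardIter_succ' (n : ℕ) (s : S) (ξ : ℕ → E) :
    backwardIter F (n + 1) s ξ = backwardIter F n (F s (ξ n)) ξ := by
  induction n generalizing ξ with
  | zero => rfl
  | succ _ ih => exact congrArg (F · (ξ 0)) (ih fun k => ξ (k + 1))

variable [MeasurableSpace S] [MeasurableSpace E]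

lemma measurable_backwardIter (hF : Measurable fun p : S × E => F p.1 p.2) (n : ℕ) (s : S) :
    Measurable fun ξ => backwardIter F n s ξ := by
  induction n with
  | zero => exact measurable_const
  | succ n ih =>
    exact hF.comp ((ih.comp (by fun_prop : Measurable fun (ξ : ℕ → E) k => ξ (k + 1))).prodMk
      (measurable_pi_apply 0))

/-- The law of a sequence of independent random variables with law `γ`. -/
noncomputable def noiseLaw (γ : Measure E) : Measure (ℕ → E) :=
  Measure.infinitePi fun _ => γ

variable {γ : Measure E} [IsProbabilityMeasure γ]

instance : IsProbabilityMeasure (noiseLaw γ) :=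
  inferInstanceAs (IsProbabilityMeasure (Measure.infinitePi fun _ : ℕ => γ))

lemma measurePreserving_head_tail :
    MeasurePreserving (fun ξ : ℕ → E => (ξ 0, fun k => ξ (k + 1))) (noiseLaw γ)
      (γ.prod (noiseLaw γ)) := by
  have hindep : iIndepFun (fun (n : ℕ) (ξ : ℕ → E) => ξ n) (noiseLaw γ) :=
    iIndepFun_infinitePi (X := fun _ e => e) fun _ => measurable_id
  have hhead_tail : IndepFun (fun ξ : ℕ → E => ξ 0) (fun ξ k => ξ (k + 1)) (noiseLaw γ) := by
    refine IndepFun.indepFun_process (by fun_prop) (by fun_prop) fun I => ?_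
    have hdisj : Disjoint {0} (I.image (· + 1)) := by simp
    have hhead : Measurable fun x : ({0} : Finset ℕ) → E => x ⟨0, Finset.mem_singleton_self 0⟩ :=
      measurable_pi_apply (X := fun _ : ({0} : Finset ℕ) => E) _
    have htail : Measurable fun (x : I.image (· + 1) → E) (i : I) =>
        x ⟨(i : ℕ) + 1, Finset.mem_image_of_mem _ i.2⟩ :=
      measurable_pi_lambda _ fun _ => measurable_pi_apply (X := fun _ : I.image (· + 1) => E) _
    exact (hindep.indepFun_finset _ _ hdisj (by fun_prop)).comp hhead htail
  refine ⟨by fun_prop, ?_⟩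
  rw [hhead_tail.map_prod_eq_prod_map_map (by fun_prop : Measurable _).aemeasurable
    (by fun_prop : Measurable _).aemeasurable]
  congr 1
  · exact Measure.infinitePi_map_eval (fun _ : ℕ => γ) 0
  · exact Measure.map_infinitePi_infinitePi_of_inj (P := fun _ : ℕ => γ) (add_left_injective 1)

lemma measurePreserving_step_tail (hF : Measurable fun p : S × E => F p.1 p.2) (μ : Measure S)
    [SFinite μ] :
    MeasurePreserving (fun p : S × (ℕ → E) => (F p.1 (p.2 0), fun k => p.2 (k + 1)))
      (μ.prod (noiseLaw γ)) ((stepLaw F γ μ).prod (noiseLaw γ)) :=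
  ((hF.measurePreserving (μ.prod γ)).prod (MeasurePreserving.id (noiseLaw γ))).comp
    (((measurePreserving_prodAssoc μ γ (noiseLaw γ)).symm).comp
      ((MeasurePreserving.id μ).prod measurePreserving_head_tail))

lemma measurePreserving_forwardIter (hF : Measurable fun p : S × E => F p.1 p.2) (n : ℕ)
    (μ : Measure S) [IsFiniteMeasure μ] :
    MeasurePreserving (fun p : S × (ℕ → E) => forwardIter F n p.1 p.2) (μ.prod (noiseLaw γ))
      ((stepLaw F γ)^[n] μ) := by
  induction n generalizing μ with
  | zero => exact measurePreserving_fst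
  | succ n ih =>
    have := isFiniteMeasure_stepLaw (F := F) (γ := γ) μ
    exact (ih (stepLaw F γ μ)).comp (measurePreserving_step_tail hF μ)

lemma measurePreserving_backwardIter (hF : Measurable fun p : S × E => F p.1 p.2) (n : ℕ)
    (μ : Measure S) [IsProbabilityMeasure μ] :
    MeasurePreserving (fun p : S × (ℕ → E) => backwardIter F n p.1 p.2) (μ.prod (noiseLaw γ))
      ((stepLaw F γ)^[n] μ) := by
  induction n with
  | zero => exact measurePreserving_fst
  | succ n ih =>
    have hshift : MeasurePreserving
        (fun p : S × (ℕ → E) => ((p.1, fun k => p.2 (k + 1)), p.2 0))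
        (μ.prod (noiseLaw γ)) ((μ.prod (noiseLaw γ)).prod γ) :=
      ((measurePreserving_prodAssoc μ (noiseLaw γ) γ).symm).comp
        ((MeasurePreserving.id μ).prod (Measure.measurePreserving_swap.comp
          measurePreserving_head_tail))
    rw [Function.iterate_succ_apply']
    exact ((hF.measurePreserving _).comp (ih.prod (MeasurePreserving.id γ))).comp hshift

end IteratedRandomMaps

section InvariantLaw

variable {S E : Type*} {F : S → E → S} {A r : ℝ≥0}

/-- The `n`-fold compositions of the random map `F` are Lipschitz with constants `A * r ^ n` that
decay geometrically, for every choice of the noise. -/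
structure IsGeometricallyContracting [PseudoEMetricSpace S] (F : S → E → S) (A r : ℝ≥0) :
    Prop where
  lt_one : r < 1
  lipschitz : ∀ n ξ, LipschitzWith (A * r ^ n) fun s => backwardIter F n s ξ

lemma IsGeometricallyContracting.continuous [PseudoEMetricSpace S]
    (h : IsGeometricallyContracting F A r) (e : E) : Continuous fun s => F s e :=
  (h.lipschitz 1 fun _ => e).continuous

lemma IsGeometricallyContracting.tendsto_dist_backwardIter [PseudoMetricSpace S]
    (h : IsGeometricallyContracting F A r) (s s' : S) (ξ : ℕ → E) :
    Tendsto (fun n => dist (backwardIter F n s ξ) (backwardIter F n s' ξ)) atTop (𝓝 0) := by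
  have hgeom : Tendsto (fun n => (A * r ^ n : ℝ) * dist s s') atTop (𝓝 0) := by
    simpa using ((tendsto_pow_atTop_nhds_zero_of_lt_one r.2 h.lt_one).const_mul (A : ℝ)).mul_const
      (dist s s')
  exact squeeze_zero (fun n => dist_nonneg) (fun n => by
    simpa using (h.lipschitz n ξ).dist_le_mul s s') hgeom

lemma isGeometricallyContracting_of_sq_norm_equiv [SeminormedAddCommGroup S] {V : S → ℝ}
    {q c C : ℝ} (hq : 0 ≤ q) (hq1 : q < 1) (hc : 0 < c) (hlower : ∀ s, c * ‖s‖ ^ 2 ≤ V s)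
    (hupper : ∀ s, V s ≤ C * ‖s‖ ^ 2) (hstep : ∀ s s' e, V (F s e - F s' e) ≤ q * V (s - s')) :
    IsGeometricallyContracting F (Real.sqrt (C / c)).toNNReal (Real.sqrt q).toNNReal := by
  have hiter : ∀ n s s' ξ, V (backwardIter F n s ξ - backwardIter F n s' ξ)
      ≤ q ^ n * V (s - s') := by
    intro n s s' ξ
    induction n generalizing ξ with
    | zero => simp [backwardIter]
    | succ n ih =>
      rw [pow_succ', mul_assoc]
      exact (hstep _ _ _).trans (mul_le_mul_of_nonneg_left (ih _) hq)
  refine ⟨by simpa [Real.sqrt_lt' one_pos] using hq1, fun n ξ =>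
    LipschitzWith.of_dist_le_mul fun s s' => ?_⟩
  have hsq : ‖backwardIter F n s ξ - backwardIter F n s' ξ‖ ^ 2 ≤ C / c * q ^ n * ‖s - s'‖ ^ 2 := by
    rw [div_mul_eq_mul_div, div_mul_eq_mul_div, le_div_iff₀' hc]
    calc _ ≤ q ^ n * V (s - s') := (hlower _).trans (hiter n s s' ξ)
      _ ≤ q ^ n * (C * ‖s - s'‖ ^ 2) := by gcongr; exact hupper _
      _ = C * q ^ n * ‖s - s'‖ ^ 2 := by ring
  rw [dist_eq_norm, dist_eq_norm, NNReal.coe_mul, NNReal.coe_pow,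
    Real.coe_toNNReal _ (Real.sqrt_nonneg _), Real.coe_toNNReal _ (Real.sqrt_nonneg _)]
  have hpow : Real.sqrt (q ^ n) = Real.sqrt q ^ n := by
    rw [Real.sqrt_eq_iff_eq_sq (by positivity) (by positivity), pow_right_comm, Real.sq_sqrt hq]
  calc _ ≤ Real.sqrt (C / c * q ^ n * ‖s - s'‖ ^ 2) := Real.le_sqrt_of_sq_le hsq
    _ = Real.sqrt (C / c) * Real.sqrt q ^ n * ‖s - s'‖ := by
      rw [Real.sqrt_mul' _ (sq_nonneg _), Real.sqrt_mul' _ (pow_nonneg hq n),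
        Real.sqrt_sq (norm_nonneg _), hpow]

variable [MeasurableSpace E] {γ : Measure E} [IsProbabilityMeasure γ]

lemma exists_ae_tendsto_of_tsum_eLpNorm_sub_ne_top {α : Type*} [MeasurableSpace α] {μ : Measure α}
    [NormedAddCommGroup S] [CompleteSpace S] [MeasurableSpace S] [BorelSpace S]
    {p : ℝ≥0∞} (hp : 1 ≤ p) {f : ℕ → α → S} (hf : ∀ n, AEStronglyMeasurable (f n) μ)
    (hf₀ : MemLp (f 0) p μ) (hsum : ∑' n, eLpNorm (f (n + 1) - f n) p μ ≠ ∞) :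
    ∃ Z : α → S, Measurable Z ∧ MemLp Z p μ ∧
      ∀ᵐ x ∂μ, Tendsto (fun n => f n x) atTop (𝓝 (Z x)) := by
  have hdiff : ∀ n, AEStronglyMeasurable (f (n + 1) - f n) μ := fun n => (hf (n + 1)).sub (hf n)
  have htelescope : ∀ n, f 0 + ∑ k ∈ Finset.range n, (f (k + 1) - f k) = f n := fun n => by
    rw [Finset.sum_range_sub, add_sub_cancel]
  obtain ⟨Z, hZm, hZ⟩ := measurable_limit_of_tendsto_metrizable_ae (L := atTop)
    (fun n => (hf n).aemeasurable) (by
      filter_upwards [summable_norm_of_tsum_eLpNorm_ne_top hp hdiff hsum] with x hx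
      refine ⟨f 0 x + ∑' n, (f (n + 1) - f n) x, ?_⟩
      refine (hx.of_norm.hasSum.tendsto_sum_nat.const_add (f 0 x)).congr fun n => ?_
      simpa using congrFun (htelescope n) x)
  refine ⟨Z, hZm, ⟨(aestronglyMeasurable_of_tendsto_ae atTop hf hZ), ?_⟩, hZ⟩
  refine (Lp.eLpNorm_le_of_ae_tendsto (Eventually.of_forall fun n => ?_) hf hZ).trans_lt
    (ENNReal.add_lt_top.mpr ⟨hf₀.2, hsum.lt_top⟩)
  rw [← htelescope n]
  calc _ ≤ eLpNorm (f 0) p μ + eLpNorm (∑ k ∈ Finset.range n, (f (k + 1) - f k)) p μ :=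
        eLpNorm_add_le (hf 0) (Finset.aestronglyMeasurable_sum _ fun k _ => hdiff k) hp
    _ ≤ eLpNorm (f 0) p μ + ∑ k ∈ Finset.range n, eLpNorm (f (k + 1) - f k) p μ := by
        gcongr
        exact eLpNorm_sum_le (fun k _ => hdiff k) hp
    _ ≤ _ := by
        gcongr
        exact ENNReal.sum_le_tsum _

lemma IsGeometricallyContracting.stepLaw_map_limit
    [EMetricSpace S] [MeasurableSpace S]
    (h : IsGeometricallyContracting F A r) (hF : Measurable fun p : S × E => F p.1 p.2)
    {Z : (ℕ → E) → S} (hZm : Measurable Z) {s : S}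
    (hZ : ∀ᵐ ξ ∂noiseLaw γ, Tendsto (fun n => backwardIter F n s ξ) atTop (𝓝 (Z ξ))) :
    stepLaw F γ ((noiseLaw γ).map Z) = (noiseLaw γ).map Z := by
  have hshift : MeasurePreserving (fun ξ : ℕ → E => (Z fun k => ξ (k + 1), ξ 0)) (noiseLaw γ)
      (((noiseLaw γ).map Z).prod γ) :=
    ((hZm.measurePreserving _).prod (MeasurePreserving.id γ)).comp
      (Measure.measurePreserving_swap.comp measurePreserving_head_tail)
  have htail : MeasurePreserving (fun (ξ : ℕ → E) k => ξ (k + 1)) (noiseLaw γ) (noiseLaw γ) :=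
    measurePreserving_snd.comp measurePreserving_head_tail
  have hfixed : (fun ξ => F (Z fun k => ξ (k + 1)) (ξ 0)) =ᵐ[noiseLaw γ] Z := by
    filter_upwards [hZ, htail.quasiMeasurePreserving.ae hZ] with ξ hξ hξ_tail
    exact tendsto_nhds_unique (((h.continuous (ξ 0)).tendsto _).comp hξ_tail)
      (hξ.comp (tendsto_add_atTop_nat 1))
  rw [stepLaw, ← hshift.map_eq, Measure.map_map hF hshift.measurable]
  exact Measure.map_congr hfixed

variable [NormedAddCommGroup S]

lemma IsGeometricallyContracting.eLpNorm_backwardIter_succ_sub_le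
    (h : IsGeometricallyContracting F A r) {p : ℝ≥0∞} (hF₀ : AEStronglyMeasurable (F 0) γ) (n : ℕ) :
    eLpNorm ((backwardIter F (n + 1) 0 : (ℕ → E) → S) - backwardIter F n 0) p (noiseLaw γ)
      ≤ A * r ^ n * eLpNorm (F 0) p γ := by
  have heval : MeasurePreserving (fun ξ : ℕ → E => ξ n) (noiseLaw γ) γ :=
    measurePreserving_eval_infinitePi (fun _ : ℕ => γ) n
  have hle : ∀ ξ, ‖((backwardIter F (n + 1) 0 : (ℕ → E) → S) - backwardIter F n 0) ξ‖₊
      ≤ A * r ^ n * ‖F 0 (ξ n)‖₊ := fun ξ => by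
    rw [Pi.sub_apply, backwardIter_succ', ← nndist_eq_nnnorm, ← nndist_zero_right (F 0 (ξ n))]
    exact (h.lipschitz n ξ).nndist_le (F 0 (ξ n)) 0
  have hnorm := eLpNorm_le_nnreal_smul_eLpNorm_of_ae_le_mul (ae_of_all (noiseLaw γ) hle) p
  rw [← eLpNorm_comp_measurePreserving hF₀ heval]
  simpa [ENNReal.smul_def, Function.comp_def] using hnorm

variable [MeasurableSpace S] [BorelSpace S]

lemma eq_map_limit_of_stepLaw_eq_self (hF : Measurable fun p : S × E => F p.1 p.2)
    {Z : (ℕ → E) → S} (hZm : Measurable Z)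
    (hZ : ∀ᵐ ξ ∂noiseLaw γ, ∀ s, Tendsto (fun n => backwardIter F n s ξ) atTop (𝓝 (Z ξ)))
    {ρ : Measure S} [IsProbabilityMeasure ρ] (hρ : stepLaw F γ ρ = ρ) : ρ = (noiseLaw γ).map Z := by
  have hlaw : ∀ n, MeasurePreserving (fun p : S × (ℕ → E) => backwardIter F n p.1 p.2)
      (ρ.prod (noiseLaw γ)) ρ := fun n => by
    simpa only [Function.iterate_fixed hρ n] using measurePreserving_backwardIter (γ := γ) hF n ρ
  have hlim : TendstoInDistribution
      (fun n (p : S × (ℕ → E)) => backwardIter F n p.1 p.2) atTop (fun p => Z p.2)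
      (fun _ => ρ.prod (noiseLaw γ)) (ρ.prod (noiseLaw γ)) := by
    refine tendstoInDistribution_of_ae_tendsto (fun n => (hlaw n).measurable.aemeasurable)
      (by fun_prop) ?_
    filter_upwards [measurePreserving_snd.quasiMeasurePreserving.ae hZ] with p hp
    exact hp p.1
  have hconst : TendstoInDistribution
      (fun n (p : S × (ℕ → E)) => backwardIter F n p.1 p.2) atTop Prod.fst
      (fun _ => ρ.prod (noiseLaw γ)) (ρ.prod (noiseLaw γ)) :=
    tendstoInDistribution_of_identDistrib 0 (fun n => ⟨(hlaw 0).measurable.aemeasurable,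
      (hlaw n).measurable.aemeasurable, (hlaw 0).map_eq.trans (hlaw n).map_eq.symm⟩)
      (IdentDistrib.refl measurable_fst.aemeasurable)
  calc ρ = (ρ.prod (noiseLaw γ)).map Prod.fst := measurePreserving_fst.map_eq.symm
    _ = (ρ.prod (noiseLaw γ)).map (Z ∘ Prod.snd) := tendstoInDistribution_unique _ hconst hlim
    _ = (noiseLaw γ).map Z := by
      rw [← Measure.map_map hZm measurable_snd, measurePreserving_snd.map_eq]

variable [SecondCountableTopology S] [CompleteSpace S]

lemma IsGeometricallyContracting.exists_tendsto_backwardIter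
    (h : IsGeometricallyContracting F A r) (hF : Measurable fun p : S × E => F p.1 p.2)
    {p : ℝ≥0∞} (hp : 1 ≤ p) (hF₀ : MemLp (F 0) p γ) :
    ∃ Z : (ℕ → E) → S, Measurable Z ∧ MemLp Z p (noiseLaw γ) ∧
      ∀ᵐ ξ ∂noiseLaw γ, ∀ s, Tendsto (fun n => backwardIter F n s ξ) atTop (𝓝 (Z ξ)) := by
  obtain ⟨Z, hZm, hZp, hZ⟩ := exists_ae_tendsto_of_tsum_eLpNorm_sub_ne_top (μ := noiseLaw γ) hp
    (fun n => (measurable_backwardIter hF n 0).aestronglyMeasurable) (memLp_const 0) (by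
      refine ne_top_of_le_ne_top ?_ (ENNReal.tsum_le_tsum fun n =>
        h.eLpNorm_backwardIter_succ_sub_le hF₀.1 n)
      rw [ENNReal.tsum_mul_right, ENNReal.tsum_mul_left, ENNReal.tsum_geometric]
      have hr : (1 - r : ℝ≥0∞)⁻¹ ≠ ∞ :=
        ENNReal.inv_ne_top.mpr (tsub_pos_of_lt (by exact_mod_cast h.lt_one)).ne'
      finiteness [hF₀.2.ne])
  refine ⟨Z, hZm, hZp, ?_⟩
  filter_upwards [hZ] with ξ hξ s
  exact (tendsto_iff_of_dist (h.tendsto_dist_backwardIter s 0 ξ)).mpr hξ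

/-- Existence by Letac's principle: the backward iterates converge pathwise, and their limit does
not depend on the initial state. -/
theorem IsGeometricallyContracting.exists_unique_invariant
    (h : IsGeometricallyContracting F A r) (hF : Measurable fun p : S × E => F p.1 p.2)
    {p : ℝ≥0∞} (hp : 1 ≤ p) (hF₀ : MemLp (F 0) p γ) :
    ∃ ρ : Measure S, IsProbabilityMeasure ρ ∧ MemLp id p ρ ∧
      ∀ ρ' : Measure S, IsProbabilityMeasure ρ' → (stepLaw F γ ρ' = ρ' ↔ ρ' = ρ) := by
  obtain ⟨Z, hZm, hZp, hZ⟩ := h.exists_tendsto_backwardIter hF hp hF₀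
  refine ⟨(noiseLaw γ).map Z, Measure.isProbabilityMeasure_map hZm.aemeasurable,
    (memLp_map_measure_iff aestronglyMeasurable_id hZm.aemeasurable).mpr hZp, fun ρ' _ =>
    ⟨eq_map_limit_of_stepLaw_eq_self hF hZm hZ, ?_⟩⟩
  rintro rfl
  exact h.stepLaw_map_limit hF hZm (hZ.mono fun ξ hξ => hξ 0)

end InvariantLaw

section PrimalUpdate

lemma memLp_comp_of_lipschitzWith {α E F : Type*} [MeasurableSpace α] {μ : Measure α}
    [IsFiniteMeasure μ] [NormedAddCommGroup E] [NormedAddCommGroup F] {p : ℝ≥0∞} {C : ℝ≥0}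
    {g : E → F} (hg : LipschitzWith C g) {f : α → E} (hf : MemLp f p μ) :
    MemLp (fun x => g (f x)) p μ := by
  have hcentered : LipschitzWith C fun x => g x - g 0 := fun x y => by
    simpa only [edist_sub_right] using hg x y
  simpa [Function.comp_def, Pi.add_def] using
    (hcentered.comp_memLp (sub_self (g 0)) hf).add (memLp_const (g 0))

variable {d m : ℕ} {τ σ θ ωg ωf : ℝ}

/-- The properties shared by the primal updates `v, ξ ↦ Xⁿ⁺¹` of both algorithms, where `ωg` is the
modulus of strong convexity of `g`. -/
structure IsPrimalUpdate (τ ωg : ℝ) (primal : Primal d → Primal d → Primal d) : Prop where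
  monotone : ∀ v v' ξ, τ * ωg * ‖primal v ξ - primal v' ξ‖ ^ 2
    ≤ ⟪(v - v') - (primal v ξ - primal v' ξ), primal v ξ - primal v' ξ⟫_ℝ
  continuous : Continuous fun p : Primal d × Primal d => primal p.1 p.2
  memLp : ∀ v, MemLp (primal v) 2 (stdGaussian (Primal d))

lemma IsPotential.isPrimalUpdate_modified {g : Primal d → EReal} (hg : IsPotential g)
    (hω : IsStronglyConvex ωg g) (hτ : 0 < τ) :
    IsPrimalUpdate τ ωg fun v ξ => prox τ g (v + Real.sqrt (2 * τ) • ξ) where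
  monotone v v' ξ := by
    have h := hg.prox_monotone hω hτ (v + Real.sqrt (2 * τ) • ξ) (v' + Real.sqrt (2 * τ) • ξ)
    rwa [add_sub_add_right_eq_sub] at h
  continuous := (hg.lipschitzWith_prox hτ).continuous.comp (by fun_prop)
  memLp v := memLp_comp_of_lipschitzWith (hg.lipschitzWith_prox hτ)
    ((memLp_const v).add (IsGaussian.memLp_two_id.const_smul (Real.sqrt (2 * τ))))

lemma IsPotential.isPrimalUpdate_ulpda {g : Primal d → EReal} (hg : IsPotential g)
    (hω : IsStronglyConvex ωg g) (hτ : 0 < τ) :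
    IsPrimalUpdate τ ωg fun v ξ => prox τ g v + Real.sqrt (2 * τ) • ξ where
  monotone v v' ξ := by
    rw [add_sub_add_right_eq_sub]
    exact hg.prox_monotone hω hτ v v'
  continuous := ((hg.lipschitzWith_prox hτ).continuous.comp continuous_fst).add (by fun_prop)
  memLp v := (memLp_const (prox τ g v)).add
    (IsGaussian.memLp_two_id.const_smul (Real.sqrt (2 * τ)))

variable {K : Primal d →L[ℝ] Dual m} {f : Dual m → EReal}
  {primal : Primal d → Primal d → Primal d}

lemma continuous_pdStep (hf : IsPotential f) (hσ : 0 < σ) (hp : IsPrimalUpdate τ ωg primal) :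
    Continuous fun p : (Primal d × Primal d × Dual m) × Primal d =>
      pdStep primal f K τ σ θ p.1 p.2 := by
  have hy : Continuous fun p : (Primal d × Primal d × Dual m) × Primal d =>
      prox σ (conj f) (p.1.2.2 + σ • K p.1.2.1) :=
    (hf.conj.lipschitzWith_prox hσ).continuous.comp (by fun_prop)
  have hx : Continuous fun p : (Primal d × Primal d × Dual m) × Primal d =>
      primal (p.1.1 - τ • (ContinuousLinearMap.adjoint K)
        (prox σ (conj f) (p.1.2.2 + σ • K p.1.2.1))) p.2 :=
    hp.continuous.comp₂ (by fun_prop) continuous_snd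
  exact hx.prodMk ((hx.add ((hx.sub (by fun_prop)).const_smul θ)).prodMk hy)

lemma IsPrimalUpdate.memLp_pdStep (hp : IsPrimalUpdate τ ωg primal)
    (s : Primal d × Primal d × Dual m) :
    MemLp (pdStep primal f K τ σ θ s) 2 (stdGaussian (Primal d)) := by
  have hx := hp.memLp
    (s.1 - τ • (ContinuousLinearMap.adjoint K) (prox σ (conj f) (s.2.2 + σ • K s.2.1)))
  exact MemLp.of_fst_snd ⟨hx, MemLp.of_fst_snd
    ⟨hx.add ((hx.sub (memLp_const s.1)).const_smul θ), memLp_const _⟩⟩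

lemma Admissible.energy_pdStep_le (h : Admissible τ σ θ ωg ωf ‖K‖) (hf : IsPotential f)
    (hω : IsStronglyConvex ωf (conj f)) (hp : IsPrimalUpdate τ ωg primal)
    (s s' : Primal d × Primal d × Dual m) (ξ : Primal d) :
    energy K τ σ θ ωg ωf (pdStep primal f K τ σ θ s ξ - pdStep primal f K τ σ θ s' ξ)
      ≤ θ * energy K τ σ θ ωg ωf (s - s') := by
  have hθ := h.theta_pos.ne'
  unfold energy
  simp only [pdStep, Prod.fst_sub, Prod.snd_sub]
  set y := prox σ (conj f) (s.2.2 + σ • K s.2.1)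
  set y' := prox σ (conj f) (s'.2.2 + σ • K s'.2.1)
  set x := primal (s.1 - τ • (ContinuousLinearMap.adjoint K) y) ξ
  set x' := primal (s'.1 - τ • (ContinuousLinearMap.adjoint K) y') ξ
  have hincrement : x + θ • (x - s.1) - (x' + θ • (x' - s'.1)) - (x - x')
      = θ • ((x - x') - (s.1 - s'.1)) := by module
  rw [hincrement, inv_smul_smul₀ hθ]
  refine h.energyForm_le_mul ?_ ?_
  · rw [smul_inv_smul₀ hθ, add_sub_cancel, map_sub, smul_sub, ← add_sub_add_comm]
    exact hf.conj.prox_monotone hω h.sigma_pos _ _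
  · rw [map_sub, smul_sub, sub_sub_sub_comm s.1]
    exact hp.monotone _ _ ξ

lemma Admissible.exists_isGeometricallyContracting (h : Admissible τ σ θ ωg ωf ‖K‖)
    (hθ1 : θ < 1) (hlt : θ * σ * τ * ‖K‖ ^ 2 < 1) (hf : IsPotential f)
    (hω : IsStronglyConvex ωf (conj f)) (hp : IsPrimalUpdate τ ωg primal) :
    ∃ A r, IsGeometricallyContracting (pdStep primal f K τ σ θ) A r := by
  obtain ⟨c, hc, hlower⟩ := h.exists_norm_sq_le_energy hlt
  obtain ⟨C, -, hupper⟩ := h.exists_energy_le (K := K)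
  exact ⟨_, _, isGeometricallyContracting_of_sq_norm_equiv h.theta_pos.le hθ1 hc hlower hupper
    (h.energy_pdStep_le hf hω hp)⟩

lemma Admissible.transportDist_pdStep_iterate_le (h : Admissible τ σ θ ωg ωf ‖K‖)
    (hf : IsPotential f) (hω : IsStronglyConvex ωf (conj f)) (hp : IsPrimalUpdate τ ωg primal)
    {A B : Type*} [MeasurableSpace A] [AddGroup A] [MeasurableSpace B] [AddGroup B]
    {nrmA : A → ℝ} {nrmB : B → ℝ} {init : A → Primal d × Primal d × Dual m}
    {proj : Primal d × Primal d × Dual m → B} (hinit : Measurable init) (hproj : Measurable proj)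
    (hcost : Measurable fun p : B × B => nrmB (p.1 - p.2)) {a b : ℝ} (ha : 0 < a) (hb : 0 < b)
    (hin : ∀ z z', energy K τ σ θ ωg ωf (init z - init z') ≤ a * nrmA (z - z') ^ 2)
    (hout : ∀ s s', b * nrmB (proj s - proj s') ^ 2 ≤ energy K τ σ θ ωg ωf (s - s'))
    (n : ℕ) (μ μ' : Measure A) [IsFiniteMeasure μ] :
    transportDist nrmB
        (((stepLaw (pdStep primal f K τ σ θ) (stdGaussian (Primal d)))^[n] (μ.map init)).map proj)
        (((stepLaw (pdStep primal f K τ σ θ) (stdGaussian (Primal d)))^[n] (μ'.map init)).map proj)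
      ≤ ENNReal.ofReal ((b / a) ^ (-(1 / 2) : ℝ) * θ ^ ((n : ℝ) / 2))
        * transportDist nrmA μ μ' := by
  have hθ := h.theta_pos
  have hfactor : ENNReal.ofReal ((b / a) ^ (-(1 / 2) : ℝ) * θ ^ ((n : ℝ) / 2))
      = (ENNReal.ofReal θ ^ n * ENNReal.ofReal (a / b)) ^ (1 / 2 : ℝ) := by
    rw [Real.rpow_neg (by positivity), ← Real.inv_rpow (by positivity), inv_div,
      div_eq_mul_one_div (n : ℝ), Real.rpow_mul hθ.le, Real.rpow_natCast,
      ← Real.mul_rpow (by positivity) (by positivity),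
      ← ENNReal.ofReal_rpow_of_nonneg (by positivity) (by norm_num),
      ENNReal.ofReal_mul (by positivity), ENNReal.ofReal_pow hθ.le, mul_comm]
  rw [hfactor]
  refine transportDist_stepLaw_iterate_le
    (W := fun p => ENNReal.ofReal (energy K τ σ θ ωg ωf (p.1 - p.2) / b))
    (continuous_pdStep hf h.sigma_pos hp).measurable hinit hproj hcost
    ((((continuous_energy K τ σ θ ωg ωf).measurable.comp measurable_sub).div_const
      b).ennreal_ofReal) (by positivity) ENNReal.ofReal_ne_top (by positivity)
    ENNReal.ofReal_ne_top (fun z z' => ?_) (fun s s' e => ?_) (fun s s' => ?_) n μ μ'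
  · rw [← ENNReal.ofReal_mul (by positivity), div_mul_eq_mul_div]
    exact ENNReal.ofReal_le_ofReal (by gcongr; exact hin z z')
  · rw [← ENNReal.ofReal_mul hθ.le, ← mul_div_assoc]
    exact ENNReal.ofReal_le_ofReal (by gcongr; exact h.energy_pdStep_le hf hω hp s s' e)
  · exact ENNReal.ofReal_le_ofReal ((le_div_iff₀' hb).mpr (hout s s'))

end PrimalUpdate

section PrimalDual

variable {d m : ℕ} {τ σ θ ωg ωf : ℝ} {K : Primal d →L[ℝ] Dual m} {f : Dual m → EReal}
  {primal : Primal d → Primal d → Primal d}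

/-- The initial state `(X⁰, X⁰, Y⁰)` of the chain with initial value `(X⁰, Y⁰)`. -/
def initState (z : Primal d × Dual m) : Primal d × Primal d × Dual m := (z.1, z.1, z.2)

/-- The primal-dual variable `(X, Y)` of a state `(X, X_θ, Y)`. -/
def primalDual (s : Primal d × Primal d × Dual m) : Primal d × Dual m := (s.1, s.2.2)

lemma measurable_initState : Measurable (initState : Primal d × Dual m → _) := by
  unfold initState
  fun_prop

lemma measurable_primalDual :
    Measurable (primalDual : Primal d × Primal d × Dual m → Primal d × Dual m) := by
  unfold primalDual
  fun_prop

lemma states_eq_forwardIter {Ω : Type*}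
    (step : Primal d × Primal d × Dual m → Primal d → Primal d × Primal d × Dual m)
    (z₀ : Ω → Primal d × Dual m) (ξ : ℕ → Ω → Primal d) (n : ℕ) (w : Ω) :
    states step z₀ ξ n w = forwardIter step n (initState (z₀ w)) fun k => ξ k w := by
  induction n with
  | zero => rfl
  | succ n ih => rw [states, ih, forwardIter_succ']

lemma memLp_initState {Ω : Type*} [MeasurableSpace Ω] {P : Measure Ω}
    {z₀ : Ω → Primal d × Dual m} {p : ℝ≥0∞} (hz : MemLp z₀ p P) :
    MemLp (fun w => initState (z₀ w)) p P :=
  MemLp.of_fst_snd ⟨hz.fst, MemLp.of_fst_snd ⟨hz.fst, hz.snd⟩⟩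

section Input

variable {Ω : Type*} [MeasurableSpace Ω] {P : Measure Ω} [IsProbabilityMeasure P]
  {z₀ : Ω → Primal d × Dual m} {ξ : ℕ → Ω → Primal d}

lemma IsInput.measurePreserving_initState (hz : IsInput P z₀ ξ) :
    MeasurePreserving (fun w => (initState (z₀ w), fun n => ξ n w)) P
      (((P.map z₀).map initState).prod (noiseLaw (stdGaussian (Primal d)))) := by
  have hξ : Measurable fun w n => ξ n w := measurable_pi_lambda _ hz.measurable_noise
  have hjoint : MeasurePreserving (fun w => (z₀ w, fun n => ξ n w)) P
      ((P.map z₀).prod (noiseLaw (stdGaussian (Primal d)))) := by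
    refine ⟨hz.measurable_init.prodMk hξ, ?_⟩
    rw [hz.init_indep.map_prod_eq_prod_map_map hz.measurable_init.aemeasurable hξ.aemeasurable,
      hz.noise_indep.map_fun_eq_infinitePi_map hz.measurable_noise]
    simp only [hz.noise_law, noiseLaw]
  exact ((measurable_initState.measurePreserving _).prod (MeasurePreserving.id _)).comp hjoint

lemma IsInput.map_iterates (hz : IsInput P z₀ ξ)
    {step : Primal d × Primal d × Dual m → Primal d → Primal d × Primal d × Dual m}
    (hstep : Measurable fun p : (Primal d × Primal d × Dual m) × Primal d => step p.1 p.2) (n : ℕ) :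
    P.map (iterates step z₀ ξ n)
      = ((stepLaw step (stdGaussian (Primal d)))^[n] ((P.map z₀).map initState)).map
        primalDual := by
  have hstate := (measurePreserving_forwardIter (γ := stdGaussian (Primal d)) hstep n
    ((P.map z₀).map initState)).comp hz.measurePreserving_initState
  rw [← hstate.map_eq, Measure.map_map measurable_primalDual hstate.measurable]
  congr 1
  ext1 w
  simp only [iterates, states_eq_forwardIter, primalDual, Function.comp_apply]

end Input

/-- The ratio of the weights of the dual and of the primal variable in the energy, which is
`λ⁻¹` in the convex and `λ̃⁻¹` in the strongly convex case. -/
noncomputable def weightRatio (τ σ ωg ωf : ℝ) : ℝ := weight σ ωf / weight τ ωg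

lemma weightedNorm_one_sq {E F : Type*} [NormedAddCommGroup E] [NormedAddCommGroup F] {b : ℝ}
    (hb : 0 ≤ b) (z : E × F) : weightedNorm 1 b z ^ 2 = ‖z.1‖ ^ 2 + b * ‖z.2‖ ^ 2 := by
  rw [weightedNorm, Real.sq_sqrt (by positivity), one_mul]

lemma measurable_weightedNorm_sub {E F : Type*} [NormedAddCommGroup E] [NormedAddCommGroup F]
    [MeasurableSpace E] [BorelSpace E] [SecondCountableTopology E] [MeasurableSpace F]
    [BorelSpace F] [SecondCountableTopology F] {a b : ℝ} :
    Measurable fun p : (E × F) × (E × F) => weightedNorm a b (p.1 - p.2) := by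
  unfold weightedNorm
  fun_prop

lemma Admissible.weight_mul_weightedNorm_sq {L : ℝ} (h : Admissible τ σ θ ωg ωf L)
    {E F : Type*} [NormedAddCommGroup E] [NormedAddCommGroup F] (z : E × F) :
    weight τ ωg * weightedNorm 1 (weightRatio τ σ ωg ωf) z ^ 2
      = weight τ ωg * ‖z.1‖ ^ 2 + weight σ ωf * ‖z.2‖ ^ 2 := by
  have ha := weight_pos h.tau_pos h.omega_g_nonneg
  have hb := weight_pos h.sigma_pos h.omega_f_nonneg
  rw [weightRatio, weightedNorm_one_sq (by positivity)]
  field_simp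

lemma Admissible.energy_initState_sub {L : ℝ} (h : Admissible τ σ θ ωg ωf L)
    (z z' : Primal d × Dual m) :
    energy K τ σ θ ωg ωf (initState z - initState z')
      = weight τ ωg * weightedNorm 1 (weightRatio τ σ ωg ωf) (z - z') ^ 2 :=
  (energy_diag K τ σ θ ωg ωf (z - z').1 (z - z').2).trans (h.weight_mul_weightedNorm_sq _).symm

lemma Admissible.mul_weightedNorm_primalDual_sq_le (h : Admissible τ σ θ ωg ωf ‖K‖)
    (s : Primal d × Primal d × Dual m) :
    weight τ ωg * (1 - θ * σ * τ * ‖K‖ ^ 2)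
        * weightedNorm 1 (weightRatio τ σ ωg ωf) (primalDual s) ^ 2
      ≤ energy K τ σ θ ωg ωf s := by
  have ha := weight_pos h.tau_pos h.omega_g_nonneg
  have hκ : 0 ≤ θ * σ * τ * ‖K‖ ^ 2 * (weight τ ωg * ‖s.1‖ ^ 2) := by
    have := h.tau_pos
    have := h.sigma_pos
    have := h.theta_pos
    positivity
  calc weight τ ωg * (1 - θ * σ * τ * ‖K‖ ^ 2)
        * weightedNorm 1 (weightRatio τ σ ωg ωf) (primalDual s) ^ 2
      = (1 - θ * σ * τ * ‖K‖ ^ 2) * (weight τ ωg * ‖s.1‖ ^ 2 + weight σ ωf * ‖s.2.2‖ ^ 2) := by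
        rw [mul_right_comm, h.weight_mul_weightedNorm_sq, primalDual, mul_comm]
    _ ≤ weight τ ωg * ‖s.1‖ ^ 2 + (1 - θ * σ * τ * ‖K‖ ^ 2) * weight σ ωf * ‖s.2.2‖ ^ 2 := by
        linarith
    _ ≤ energy K τ σ θ ωg ωf s := h.le_energy s

lemma Admissible.mul_norm_fst_sq_le (h : Admissible τ σ θ ωg ωf ‖K‖)
    (s : Primal d × Primal d × Dual m) :
    weight τ ωg * ‖s.1‖ ^ 2 ≤ energy K τ σ θ ωg ωf s := by
  have hb := weight_pos h.sigma_pos h.omega_f_nonneg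
  have hκ : 0 ≤ 1 - θ * σ * τ * ‖K‖ ^ 2 := sub_nonneg.mpr h.coupling_le
  exact (le_add_of_nonneg_right (by positivity)).trans (h.le_energy s)

variable {Ω : Type*} [MeasurableSpace Ω] {P : Measure Ω} [IsProbabilityMeasure P]
  {z₀ z₀' : Ω → Primal d × Dual m} {ξ : ℕ → Ω → Primal d}

lemma Admissible.W2_map_fst_iterates_le (h : Admissible τ σ θ ωg ωf ‖K‖) (hf : IsPotential f)
    (hω : IsStronglyConvex ωf (conj f)) (hp : IsPrimalUpdate τ ωg primal) (hz : IsInput P z₀ ξ)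
    (hz' : IsInput P z₀' ξ) (n : ℕ) :
    W2 ((P.map (iterates (pdStep primal f K τ σ θ) z₀ ξ n)).map Prod.fst)
        ((P.map (iterates (pdStep primal f K τ σ θ) z₀' ξ n)).map Prod.fst)
      ≤ ENNReal.ofReal (θ ^ ((n : ℝ) / 2))
        * T 1 (weightRatio τ σ ωg ωf) (P.map z₀) (P.map z₀') := by
  have hstep := (continuous_pdStep (K := K) (θ := θ) hf h.sigma_pos hp).measurable
  have ha := weight_pos h.tau_pos h.omega_g_nonneg
  rw [hz.map_iterates hstep, hz'.map_iterates hstep,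
    Measure.map_map measurable_fst measurable_primalDual,
    Measure.map_map measurable_fst measurable_primalDual]
  refine (h.transportDist_pdStep_iterate_le hf hω hp measurable_initState
    (measurable_fst.comp measurable_primalDual) (by fun_prop) ha ha
    (fun z z' => (h.energy_initState_sub z z').le) (fun s s' => h.mul_norm_fst_sq_le (s - s'))
    n (P.map z₀) (P.map z₀')).trans_eq ?_
  rw [div_self ha.ne', Real.one_rpow, one_mul, T]

lemma Admissible.T_iterates_le (h : Admissible τ σ θ ωg ωf ‖K‖)
    (hlt : θ * σ * τ * ‖K‖ ^ 2 < 1) (hf : IsPotential f) (hω : IsStronglyConvex ωf (conj f))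
    (hp : IsPrimalUpdate τ ωg primal) (hz : IsInput P z₀ ξ) (hz' : IsInput P z₀' ξ) (n : ℕ) :
    T 1 (weightRatio τ σ ωg ωf) (P.map (iterates (pdStep primal f K τ σ θ) z₀ ξ n))
        (P.map (iterates (pdStep primal f K τ σ θ) z₀' ξ n))
      ≤ ENNReal.ofReal ((1 - θ * σ * τ * ‖K‖ ^ 2) ^ (-(1 / 2) : ℝ) * θ ^ ((n : ℝ) / 2))
        * T 1 (weightRatio τ σ ωg ωf) (P.map z₀) (P.map z₀') := by
  have hstep := (continuous_pdStep (K := K) (θ := θ) hf h.sigma_pos hp).measurable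
  have ha := weight_pos h.tau_pos h.omega_g_nonneg
  rw [hz.map_iterates hstep, hz'.map_iterates hstep]
  refine (h.transportDist_pdStep_iterate_le hf hω hp measurable_initState measurable_primalDual
    measurable_weightedNorm_sub ha (mul_pos ha (sub_pos.mpr hlt))
    (fun z z' => (h.energy_initState_sub z z').le)
    (fun s s' => h.mul_weightedNorm_primalDual_sq_le (s - s'))
    n (P.map z₀) (P.map z₀')).trans_eq ?_
  rw [mul_div_cancel_left₀ _ ha.ne', T]

/-- A coupling with finite cost is the product of the two laws. -/
lemma W2_ne_top {S : Type*} [NormedAddCommGroup S] [MeasurableSpace S] {μ ν : Measure S}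
    [IsProbabilityMeasure μ] [IsProbabilityMeasure ν] (hμ : MemLp id 2 μ) (hν : MemLp id 2 ν) :
    W2 μ ν ≠ ∞ := by
  have hprod : μ.prod ν ∈ couplings μ ν :=
    ⟨measurePreserving_fst.map_eq, measurePreserving_snd.map_eq⟩
  have hdiff : MemLp (fun p : S × S => p.1 - p.2) 2 (μ.prod ν) :=
    (hμ.comp_measurePreserving measurePreserving_fst).sub
      (hν.comp_measurePreserving measurePreserving_snd)
  refine ENNReal.rpow_ne_top_of_nonneg (by norm_num) (ne_top_of_le_ne_top ?_ (iInf₂_le _ hprod))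
  exact ((memLp_two_iff_integrable_sq_norm hdiff.1).mp hdiff).lintegral_lt_top.ne

lemma Admissible.exists_T_iterates_le_W2 (h : Admissible τ σ θ ωg ωf ‖K‖)
    (hlt : θ * σ * τ * ‖K‖ ^ 2 < 1) (hf : IsPotential f) (hω : IsStronglyConvex ωf (conj f))
    (hp : IsPrimalUpdate τ ωg primal) {ρ : Measure (Primal d × Primal d × Dual m)}
    [IsProbabilityMeasure ρ]
    (hρ : stepLaw (pdStep primal f K τ σ θ) (stdGaussian (Primal d)) ρ = ρ)
    (hz : IsInput P z₀ ξ) :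
    ∃ A : ℝ, ∀ n : ℕ, T 1 (weightRatio τ σ ωg ωf)
        (P.map (iterates (pdStep primal f K τ σ θ) z₀ ξ n)) (ρ.map primalDual)
      ≤ ENNReal.ofReal (A * θ ^ ((n : ℝ) / 2)) * W2 ((P.map z₀).map initState) ρ := by
  have hstep := (continuous_pdStep (K := K) (θ := θ) hf h.sigma_pos hp).measurable
  have ha := weight_pos h.tau_pos h.omega_g_nonneg
  have := Measure.isProbabilityMeasure_map (μ := P) hz.measurable_init.aemeasurable
  have := Measure.isProbabilityMeasure_map (μ := P.map z₀) measurable_initState.aemeasurable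
  obtain ⟨C, hC, hupper⟩ := h.exists_energy_le (K := K)
  refine ⟨(weight τ ωg * (1 - θ * σ * τ * ‖K‖ ^ 2) / C) ^ (-(1 / 2) : ℝ), fun n => ?_⟩
  have hbound := h.transportDist_pdStep_iterate_le hf hω hp measurable_id measurable_primalDual
    measurable_weightedNorm_sub hC (mul_pos ha (sub_pos.mpr hlt))
    (fun s s' => hupper (s - s')) (fun s s' => h.mul_weightedNorm_primalDual_sq_le (s - s'))
    n ((P.map z₀).map initState) ρ
  rwa [Measure.map_id, Measure.map_id, Function.iterate_fixed hρ n,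
    ← hz.map_iterates hstep] at hbound

lemma Admissible.tendsto_T_iterates (h : Admissible τ σ θ ωg ωf ‖K‖)
    (hθ1 : θ < 1) (hlt : θ * σ * τ * ‖K‖ ^ 2 < 1) (hf : IsPotential f)
    (hω : IsStronglyConvex ωf (conj f)) (hp : IsPrimalUpdate τ ωg primal)
    {ρ : Measure (Primal d × Primal d × Dual m)} [IsProbabilityMeasure ρ]
    (hρ : stepLaw (pdStep primal f K τ σ θ) (stdGaussian (Primal d)) ρ = ρ) (hρ₂ : MemLp id 2 ρ)
    (hz : IsInput P z₀ ξ) (hz₂ : MemLp z₀ 2 P) :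
    Tendsto (fun n => T 1 (weightRatio τ σ ωg ωf)
      (P.map (iterates (pdStep primal f K τ σ θ) z₀ ξ n)) (ρ.map primalDual)) atTop (𝓝 0) := by
  obtain ⟨A, hle⟩ := h.exists_T_iterates_le_W2 hlt hf hω hp hρ hz
  have := Measure.isProbabilityMeasure_map (μ := P) hz.measurable_init.aemeasurable
  have := Measure.isProbabilityMeasure_map (μ := P.map z₀) measurable_initState.aemeasurable
  have hinit₂ : MemLp id 2 ((P.map z₀).map initState) := by
    rw [Measure.map_map measurable_initState hz.measurable_init, memLp_map_measure_iff
      aestronglyMeasurable_id (measurable_initState.comp hz.measurable_init).aemeasurable]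
    exact memLp_initState hz₂
  have hpow : Tendsto (fun n : ℕ => θ ^ ((n : ℝ) / 2)) atTop (𝓝 0) :=
    (tendsto_rpow_atTop_of_base_lt_one θ (by linarith [h.theta_pos]) hθ1).comp
      (tendsto_natCast_atTop_atTop.atTop_div_const two_pos)
  have hfactor := ENNReal.Tendsto.mul_const (ENNReal.tendsto_ofReal (hpow.const_mul A))
    (Or.inr (W2_ne_top hinit₂ hρ₂))
  rw [mul_zero, ENNReal.ofReal_zero, zero_mul] at hfactor
  exact tendsto_of_tendsto_of_tendsto_of_le_of_le tendsto_const_nhds hfactor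
    (fun _ => zero_le) hle

lemma Admissible.exists_unique_invariant (h : Admissible τ σ θ ωg ωf ‖K‖)
    (hθ1 : θ < 1) (hlt : θ * σ * τ * ‖K‖ ^ 2 < 1) (hf : IsPotential f)
    (hω : IsStronglyConvex ωf (conj f)) (hp : IsPrimalUpdate τ ωg primal) :
    ∃ ρ : Measure (Primal d × Primal d × Dual m), IsProbabilityMeasure ρ ∧ MemLp id 2 ρ ∧
      ∀ ρ' : Measure (Primal d × Primal d × Dual m), IsProbabilityMeasure ρ' →
        (stepLaw (pdStep primal f K τ σ θ) (stdGaussian (Primal d)) ρ' = ρ' ↔ ρ' = ρ) := by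
  obtain ⟨A, r, hcontracting⟩ := h.exists_isGeometricallyContracting hθ1 hlt hf hω hp
  exact hcontracting.exists_unique_invariant
    (continuous_pdStep hf h.sigma_pos hp).measurable one_le_two (hp.memLp_pdStep 0)

lemma isStationaryLaw_iff_of_unique_invariant
    {step : Primal d × Primal d × Dual m → Primal d → Primal d × Primal d × Dual m}
    {ρ : Measure (Primal d × Primal d × Dual m)} [IsProbabilityMeasure ρ]
    (huniq : ∀ ρ' : Measure (Primal d × Primal d × Dual m), IsProbabilityMeasure ρ' →
      (stepLaw step (stdGaussian (Primal d)) ρ' = ρ' ↔ ρ' = ρ))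
    (ν : Measure (Primal d × Dual m)) : IsStationaryLaw step ν ↔ ν = ρ.map primalDual := by
  constructor
  · rintro ⟨ρ', hρ', hinv, rfl⟩
    rw [(huniq ρ' hρ').mp hinv]
    rfl
  · rintro rfl
    exact ⟨ρ, inferInstance, (huniq ρ inferInstance).mpr rfl, rfl⟩

end PrimalDual

section GaussianModel

lemma not_ae_eq_const_stdGaussian {E : Type*} [NormedAddCommGroup E] [InnerProductSpace ℝ E]
    [FiniteDimensional ℝ E] [MeasurableSpace E] [BorelSpace E] [Nontrivial E] (a : E) :
    ¬ ∀ᵐ ξ ∂stdGaussian E, ξ = a := by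
  intro hconst
  obtain ⟨e, he⟩ := exists_ne (0 : E)
  have hvar : Var[innerSL ℝ e; stdGaussian E] = Var[fun _ => innerSL ℝ e a; stdGaussian E] :=
    variance_congr (hconst.mono fun ξ hξ => by rw [hξ])
  rw [variance_dual_stdGaussian] at hvar
  simp [variance_eq_integral, he] at hvar

lemma ae_eq_zero_of_map_smul_eq {E : Type*} [NormedAddCommGroup E] [NormedSpace ℝ E]
    [MeasurableSpace E] [BorelSpace E] {μ : Measure E} {c : ℝ} (hc : |c| < 1)
    (hμ : μ.map (c • ·) = μ) (hint : Integrable id μ) : ∀ᵐ x ∂μ, x = 0 := by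
  have hscale : ∫ x, ‖x‖ ∂μ = |c| * ∫ x, ‖x‖ ∂μ :=
    calc ∫ x, ‖x‖ ∂μ = ∫ x, ‖x‖ ∂μ.map (c • ·) := by rw [hμ]
      _ = ∫ x, ‖c • x‖ ∂μ :=
        integral_map (measurable_const_smul c).aemeasurable (by fun_prop)
      _ = |c| * ∫ x, ‖x‖ ∂μ := by
        simp only [norm_smul, Real.norm_eq_abs, integral_const_mul]
  have hzero : ∫ x, ‖x‖ ∂μ = 0 := by nlinarith
  exact ((integral_eq_zero_iff_of_nonneg (fun x => norm_nonneg x) hint.norm).mp hzero).mono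
    fun x hx => norm_eq_zero.mp hx

variable {d m : ℕ} {K : Primal d →L[ℝ] Dual m} {τ σ θ ωg ωf : ℝ}

lemma exp_neg_quadratic_add_quadratic (ω ω' : ℝ) (x : Primal d) :
    EReal.exp (-(quadratic ω' (K x) + quadratic ω x))
      = ENNReal.ofReal (Real.exp (-(ω' / 2 * ‖K x‖ ^ 2 + ω / 2 * ‖x‖ ^ 2))) := by
  simp only [quadratic, ← EReal.coe_add, ← EReal.coe_neg, EReal.exp_coe]

lemma lintegral_exp_neg_quadratic_ne_zero (ω ω' : ℝ) :
    (∫⁻ x, EReal.exp (-(quadratic ω' (K x) + quadratic ω x))) ≠ 0 := by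
  simp only [exp_neg_quadratic_add_quadratic]
  have hsupp : Function.support (fun x : Primal d => ENNReal.ofReal
      (Real.exp (-(ω' / 2 * ‖K x‖ ^ 2 + ω / 2 * ‖x‖ ^ 2)))) = Set.univ :=
    Function.support_eq_univ fun _ => (ENNReal.ofReal_pos.mpr (Real.exp_pos _)).ne'
  rw [← pos_iff_ne_zero, lintegral_pos_iff_support (by fun_prop), hsupp]
  exact isOpen_univ.measure_pos volume Set.univ_nonempty

lemma lintegral_exp_neg_quadratic_ne_top {ω ω' : ℝ} (hω : 0 < ω) (hω' : 0 ≤ ω') :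
    (∫⁻ x, EReal.exp (-(quadratic ω' (K x) + quadratic ω x))) ≠ ∞ := by
  have hint : Integrable fun x : Primal d => Real.exp (-(ω / 2) * ‖x‖ ^ 2) := by
    refine Not.imp_symm integral_undef ?_
    rw [GaussianFourier.integral_rexp_neg_mul_sq_norm (by positivity)]
    positivity
  refine ne_top_of_le_ne_top hint.lintegral_lt_top.ne (lintegral_mono fun x => ?_)
  rw [exp_neg_quadratic_add_quadratic]
  have : 0 ≤ ω' / 2 * ‖K x‖ ^ 2 := by positivity
  gcongr
  linarith

/-- For a quadratic `g` the proximal map is the multiplication by `c = (1 + τ ωg)⁻¹`, so that adding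
the noise before it instead of after it amounts to scaling the noise by `c`; the other maps in the
step are linear as well. -/
lemma modifiedStep_smul_quadratic (hτ : 0 < τ) (hσ : 0 < σ) (hg : 0 ≤ ωg) (hf : 0 < ωf)
    (s : Primal d × Primal d × Dual m) (ξ : Primal d) :
    modifiedStep (quadratic ωf⁻¹) (quadratic ωg) K τ σ θ ((1 + τ * ωg)⁻¹ • s) ξ
      = (1 + τ * ωg)⁻¹ • ulpdaStep (quadratic ωf⁻¹) (quadratic ωg) K τ σ θ s ξ := by
  set c := (1 + τ * ωg)⁻¹
  have hdual : (1 + σ * ωf)⁻¹ • ((c • s).2.2 + σ • K (c • s).2.1)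
      = c • (1 + σ * ωf)⁻¹ • (s.2.2 + σ • K s.2.1) := by
    simp only [Prod.smul_snd, Prod.smul_fst, map_smul]
    module
  simp only [modifiedStep, ulpdaStep, pdStep, conj_quadratic hf, prox_quadratic hf.le hσ,
    prox_quadratic hg hτ, hdual]
  refine Prod.ext ?_ (Prod.ext ?_ rfl)
  all_goals
    simp only [Prod.smul_fst, Prod.smul_snd, map_smul]
    module

lemma not_ae_fst_eq_const_of_stepLaw_ulpdaStep_eq [Nontrivial (Primal d)] (hτ : 0 < τ)
    {f : Dual m → EReal} {g : Primal d → EReal}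
    {ρ : Measure (Primal d × Primal d × Dual m)} [IsProbabilityMeasure ρ]
    (hstep : Measurable fun p : (Primal d × Primal d × Dual m) × Primal d =>
      ulpdaStep f g K τ σ θ p.1 p.2)
    (hρ : stepLaw (ulpdaStep f g K τ σ θ) (stdGaussian (Primal d)) ρ = ρ) (a : Primal d) :
    ¬ ∀ᵐ s ∂ρ, s.1 = a := by
  intro hconst
  have hnext := (MeasurePreserving.mk hstep hρ).quasiMeasurePreserving.ae hconst
  obtain ⟨s, hs⟩ := (Measure.ae_ae_of_ae_prod hnext).exists
  have hsqrt : Real.sqrt (2 * τ) ≠ 0 := (Real.sqrt_pos.mpr (by positivity)).ne'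
  refine not_ae_eq_const_stdGaussian ((Real.sqrt (2 * τ))⁻¹ • (a - prox τ g (s.1 - τ •
    (ContinuousLinearMap.adjoint K) (prox σ (conj f) (s.2.2 + σ • K s.2.1)))))
    (hs.mono fun ξ hξ => ?_)
  rw [eq_inv_smul_iff₀ hsqrt, eq_sub_iff_add_eq']
  exact hξ

lemma map_primalDual_ne_map_smul [Nontrivial (Primal d)] (hτ : 0 < τ)
    {f : Dual m → EReal} {g : Primal d → EReal}
    {ρ : Measure (Primal d × Primal d × Dual m)} [IsProbabilityMeasure ρ]
    (hstep : Measurable fun p : (Primal d × Primal d × Dual m) × Primal d =>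
      ulpdaStep f g K τ σ θ p.1 p.2)
    (hρ : stepLaw (ulpdaStep f g K τ σ θ) (stdGaussian (Primal d)) ρ = ρ)
    (hint : Integrable id ρ) {c : ℝ} (hc : |c| < 1) :
    ρ.map primalDual ≠ (ρ.map (c • ·)).map primalDual := by
  intro heq
  have hsmul : Measurable fun s : Primal d × Primal d × Dual m => c • s := measurable_const_smul c
  have hfst : (ρ.map Prod.fst).map (c • ·) = ρ.map Prod.fst :=
    calc (ρ.map Prod.fst).map (c • ·) = ((ρ.map (c • ·)).map primalDual).map Prod.fst := by
          rw [Measure.map_map (measurable_const_smul c) measurable_fst,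
            Measure.map_map measurable_primalDual hsmul,
            Measure.map_map measurable_fst (measurable_primalDual.comp hsmul)]
          rfl
      _ = ρ.map Prod.fst := by
          rw [← heq, Measure.map_map measurable_fst measurable_primalDual]
          rfl
  have hint_fst : Integrable id (ρ.map Prod.fst) :=
    (integrable_map_measure aestronglyMeasurable_id measurable_fst.aemeasurable).mpr hint.fst
  exact not_ae_fst_eq_const_of_stepLaw_ulpdaStep_eq hτ hstep hρ 0
    (ae_of_ae_map measurable_fst.aemeasurable (ae_eq_zero_of_map_smul_eq hc hfst hint_fst))

lemma isStronglyConvex_conj_quadratic (hf : 0 < ωf) :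
    IsStronglyConvex ωf (conj (quadratic ωf⁻¹ : Dual m → EReal)) := by
  rw [conj_quadratic hf]
  exact isStronglyConvex_quadratic ωf

lemma Admissible.exists_isStationaryLaw_quadratic_ne [Nontrivial (Primal d)]
    (h : Admissible τ σ θ ωg ωf ‖K‖) (hθ1 : θ < 1) (hlt : θ * σ * τ * ‖K‖ ^ 2 < 1)
    (hg : 0 < ωg) (hf : 0 < ωf) :
    ∃ πorig πmod : Measure (Primal d × Dual m),
      (∀ ν, IsStationaryLaw (ulpdaStep (quadratic ωf⁻¹) (quadratic ωg) K τ σ θ) ν ↔ ν = πorig) ∧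
      (∀ ν, IsStationaryLaw (modifiedStep (quadratic ωf⁻¹) (quadratic ωg) K τ σ θ) ν
        ↔ ν = πmod) ∧
      πorig ≠ πmod := by
  have hτ := h.tau_pos
  have hfp : IsPotential (quadratic ωf⁻¹ : Dual m → EReal) :=
    isPotential_quadratic (inv_nonneg.mpr hf.le)
  have hgp : IsPotential (quadratic ωg : Primal d → EReal) := isPotential_quadratic hg.le
  have hfs := isStronglyConvex_conj_quadratic (m := m) hf
  have horig := hgp.isPrimalUpdate_ulpda (isStronglyConvex_quadratic ωg) hτ
  have hmod := hgp.isPrimalUpdate_modified (isStronglyConvex_quadratic ωg) hτ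
  have horig_meas := (continuous_pdStep (K := K) (θ := θ) hfp h.sigma_pos horig).measurable
  have hmod_meas := (continuous_pdStep (K := K) (θ := θ) hfp h.sigma_pos hmod).measurable
  obtain ⟨ρ, _, hρ₂, hρ⟩ := h.exists_unique_invariant hθ1 hlt hfp hfs horig
  obtain ⟨ρ', _, -, hρ'⟩ := h.exists_unique_invariant hθ1 hlt hfp hfs hmod
  have hinv := (hρ ρ inferInstance).mpr rfl
  set c := (1 + τ * ωg)⁻¹
  have hscaled : ρ.map (c • ·) = ρ' := by
    refine (hρ' _ (Measure.isProbabilityMeasure_map (by fun_prop))).mp ?_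
    rw [stepLaw_map horig_meas hmod_meas (measurable_const_smul c)
      (fun s ξ => (modifiedStep_smul_quadratic hτ h.sigma_pos hg.le hf s ξ).symm), hinv]
  have hc : |c| < 1 := by
    rw [abs_of_pos (by positivity)]
    exact inv_lt_one_of_one_lt₀ (lt_add_of_pos_right 1 (by positivity))
  refine ⟨ρ.map primalDual, ρ'.map primalDual, isStationaryLaw_iff_of_unique_invariant hρ,
    isStationaryLaw_iff_of_unique_invariant hρ', ?_⟩
  rw [← hscaled]
  exact map_primalDual_ne_map_smul hτ horig_meas hinv (hρ₂.integrable one_le_two) hc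

end GaussianModel

section StationaryLaw

variable {d m : ℕ} {τ σ θ ωg ωf : ℝ} {K : Primal d →L[ℝ] Dual m} {f : Dual m → EReal}
  {primal : Primal d → Primal d → Primal d}

lemma memLp_map_primalDual {ρ : Measure (Primal d × Primal d × Dual m)} {p : ℝ≥0∞}
    (hρ : MemLp id p ρ) : MemLp id p (ρ.map primalDual) :=
  (memLp_map_measure_iff aestronglyMeasurable_id measurable_primalDual.aemeasurable).mpr
    (MemLp.of_fst_snd ⟨hρ.fst, hρ.snd.snd⟩)

theorem Admissible.exists_isStationaryLaw_tendsto (h : Admissible τ σ θ ωg ωf ‖K‖)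
    (hθ1 : θ < 1) (hlt : θ * σ * τ * ‖K‖ ^ 2 < 1) (hf : IsPotential f)
    (hω : IsStronglyConvex ωf (conj f)) (hp : IsPrimalUpdate τ ωg primal) :
    ∃ πs : Measure (Primal d × Dual m),
      (∀ ν, IsStationaryLaw (pdStep primal f K τ σ θ) ν ↔ ν = πs) ∧ MemLp id 2 πs ∧
      ∀ (Ω : Type*) [MeasurableSpace Ω] (P : Measure Ω) [IsProbabilityMeasure P]
        (z₀ : Ω → Primal d × Dual m) (ξ : ℕ → Ω → Primal d), IsInput P z₀ ξ → MemLp z₀ 2 P →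
        Tendsto (fun n => T 1 (weightRatio τ σ ωg ωf)
          (P.map (iterates (pdStep primal f K τ σ θ) z₀ ξ n)) πs) atTop (𝓝 0) := by
  obtain ⟨ρ, _, hρ₂, hρ⟩ := h.exists_unique_invariant hθ1 hlt hf hω hp
  exact ⟨ρ.map primalDual, isStationaryLaw_iff_of_unique_invariant hρ, memLp_map_primalDual hρ₂,
    fun Ω _ P _ z₀ ξ hz hz₂ =>
      h.tendsto_T_iterates hθ1 hlt hf hω hp ((hρ ρ inferInstance).mpr rfl) hρ₂ hz hz₂⟩

end StationaryLaw

section Parameters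

variable {τ σ θ ωg ωf L : ℝ}

lemma admissible_of_max_le (hτ : 0 < τ) (hσ : 0 < σ) (hg : 0 < ωg) (hf : 0 < ωf)
    (hmax : max (1 + 2 * ωg * τ)⁻¹ (1 + 2 * ωf * σ)⁻¹ ≤ θ) (hθ : θ < 1)
    (hL : θ * σ * τ * L ^ 2 ≤ 1) : Admissible τ σ θ ωg ωf L where
  tau_pos := hτ
  sigma_pos := hσ
  theta_pos := lt_of_lt_of_le (by positivity) ((le_max_left _ _).trans hmax)
  theta_le := hθ.le
  omega_g_nonneg := hg.le
  omega_f_nonneg := hf.le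
  inv_g_le := (le_max_left _ _).trans hmax
  inv_f_le := (le_max_right _ _).trans hmax
  coupling_le := hL

lemma admissible_one (hτ : 0 < τ) (hσ : 0 < σ) (hL : τ * σ * L ^ 2 ≤ 1) :
    Admissible τ σ 1 0 0 L where
  tau_pos := hτ
  sigma_pos := hσ
  theta_pos := one_pos
  theta_le := le_rfl
  omega_g_nonneg := le_rfl
  omega_f_nonneg := le_rfl
  inv_g_le := by simp
  inv_f_le := by simp
  coupling_le := by rwa [one_mul, mul_comm σ τ]

lemma weightRatio_eq : weightRatio τ σ ωg ωf
    = ((1 + 2 * ωg * τ) / (1 + 2 * ωf * σ) * (σ / τ))⁻¹ := by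
  rw [weightRatio, weight, weight, div_div_div_eq, mul_left_comm, mul_assoc 2 σ,
    mul_div_mul_left _ _ two_ne_zero, div_mul_div_comm, inv_div, mul_comm σ]

lemma weightRatio_zero : weightRatio τ σ 0 0 = (σ / τ)⁻¹ := by
  simp [weightRatio_eq]

end Parameters

section Convex

variable {d m : ℕ} {τ σ : ℝ} {K : Primal d →L[ℝ] Dual m} {f : Dual m → EReal}
  {g : Primal d → EReal} {Ω : Type*} [MeasurableSpace Ω] {P : Measure Ω} [IsProbabilityMeasure P]
  {z₀ z₀' : Ω → Primal d × Dual m} {ξ : ℕ → Ω → Primal d}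

theorem W2_map_fst_iterates_modifiedStep_le (hf : IsPotential f) (hg : IsPotential g)
    (hτ : 0 < τ) (hσ : 0 < σ) (hL : τ * σ * ‖K‖ ^ 2 ≤ 1) (hz : IsInput P z₀ ξ)
    (hz' : IsInput P z₀' ξ) (n : ℕ) :
    W2 ((P.map (iterates (modifiedStep f g K τ σ 1) z₀ ξ n)).map Prod.fst)
        ((P.map (iterates (modifiedStep f g K τ σ 1) z₀' ξ n)).map Prod.fst)
      ≤ T 1 (σ / τ)⁻¹ (P.map z₀) (P.map z₀') := by
  have hbound := (admissible_one hτ hσ hL).W2_map_fst_iterates_le hf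
    hf.conj.convex.isStronglyConvex_zero
    (hg.isPrimalUpdate_modified hg.convex.isStronglyConvex_zero hτ) hz hz' n
  rwa [Real.one_rpow, ENNReal.ofReal_one, one_mul, weightRatio_zero] at hbound

theorem T_iterates_modifiedStep_le (hf : IsPotential f) (hg : IsPotential g)
    (hτ : 0 < τ) (hσ : 0 < σ) (hL : τ * σ * ‖K‖ ^ 2 < 1) (hz : IsInput P z₀ ξ)
    (hz' : IsInput P z₀' ξ) (n : ℕ) :
    T 1 (σ / τ)⁻¹ (P.map (iterates (modifiedStep f g K τ σ 1) z₀ ξ n))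
        (P.map (iterates (modifiedStep f g K τ σ 1) z₀' ξ n))
      ≤ ENNReal.ofReal ((1 - τ * σ * ‖K‖ ^ 2) ^ (-(1 / 2) : ℝ))
        * T 1 (σ / τ)⁻¹ (P.map z₀) (P.map z₀') := by
  have hcoupling : 1 * σ * τ * ‖K‖ ^ 2 = τ * σ * ‖K‖ ^ 2 := by ring
  have hbound := (admissible_one hτ hσ hL.le).T_iterates_le (hcoupling.trans_lt hL) hf
    hf.conj.convex.isStronglyConvex_zero
    (hg.isPrimalUpdate_modified hg.convex.isStronglyConvex_zero hτ) hz hz' n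
  rwa [Real.one_rpow, mul_one, hcoupling, weightRatio_zero] at hbound

end Convex

end ULPDA

theorem mainTheorem12 :
    -- stability for convex potentials, `θ = 1`
    (∀ (d m : ℕ) (K : Primal d →L[ℝ] Dual m) (f : Dual m → EReal) (g : Primal d → EReal)
      (τ σ lam : ℝ),
      IsPotential f → IsPotential g → 0 < τ → 0 < σ → lam = σ / τ → τ * σ * ‖K‖ ^ 2 ≤ 1 →
      ∀ (Ω : Type*) [MeasurableSpace Ω] (P : Measure Ω) [IsProbabilityMeasure P]
        (z₀ z₀' : Ω → Primal d × Dual m) (ξ : ℕ → Ω → Primal d),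
        IsInput P z₀ ξ → IsInput P z₀' ξ →
        ∀ π π' : ℕ → Measure (Primal d × Dual m),
          (∀ n, π n = P.map (iterates (modifiedStep f g K τ σ 1) z₀ ξ n)) →
          (∀ n, π' n = P.map (iterates (modifiedStep f g K τ σ 1) z₀' ξ n)) →
          (∀ N, W2 ((π N).map Prod.fst) ((π' N).map Prod.fst) ≤ T 1 lam⁻¹ (π 0) (π' 0)) ∧
          (τ * σ * ‖K‖ ^ 2 < 1 → ∀ N, T 1 lam⁻¹ (π N) (π' N) ≤
            ENNReal.ofReal ((1 - τ * σ * ‖K‖ ^ 2) ^ (-(1 / 2) : ℝ)) *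
              T 1 lam⁻¹ (π 0) (π' 0))) ∧
    -- contraction and convergence to a stationary distribution for strongly convex potentials
    (∀ (d m : ℕ) (K : Primal d →L[ℝ] Dual m) (f : Dual m → EReal) (g : Primal d → EReal)
      (τ σ θ ωg ωf lam lam' : ℝ),
      IsPotential f → IsPotential g → 0 < τ → 0 < σ → 0 < ωg → 0 < ωf →
      IsStronglyConvex ωg g → IsStronglyConvex ωf (conj f) →
      max (1 + 2 * ωg * τ)⁻¹ (1 + 2 * ωf * σ)⁻¹ ≤ θ → θ < 1 → θ * σ * τ * ‖K‖ ^ 2 ≤ 1 →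
      lam = σ / τ → lam' = (1 + 2 * ωg * τ) / (1 + 2 * ωf * σ) * lam →
      (∀ (Ω : Type*) [MeasurableSpace Ω] (P : Measure Ω) [IsProbabilityMeasure P]
        (z₀ z₀' : Ω → Primal d × Dual m) (ξ : ℕ → Ω → Primal d),
        IsInput P z₀ ξ → IsInput P z₀' ξ →
        ∀ π π' : ℕ → Measure (Primal d × Dual m),
          (∀ n, π n = P.map (iterates (modifiedStep f g K τ σ θ) z₀ ξ n)) →
          (∀ n, π' n = P.map (iterates (modifiedStep f g K τ σ θ) z₀' ξ n)) →
          (∀ N : ℕ, W2 ((π N).map Prod.fst) ((π' N).map Prod.fst) ≤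
            ENNReal.ofReal (θ ^ ((N : ℝ) / 2)) * T 1 lam'⁻¹ (π 0) (π' 0)) ∧
          (θ * σ * τ * ‖K‖ ^ 2 < 1 → ∀ N : ℕ, T 1 lam'⁻¹ (π N) (π' N) ≤
            ENNReal.ofReal ((1 - θ * τ * σ * ‖K‖ ^ 2) ^ (-(1 / 2) : ℝ) * θ ^ ((N : ℝ) / 2)) *
              T 1 lam'⁻¹ (π 0) (π' 0))) ∧
      (θ * σ * τ * ‖K‖ ^ 2 < 1 →
        ∃ πs : Measure (Primal d × Dual m),
          (∀ ν, IsStationaryLaw (modifiedStep f g K τ σ θ) ν ↔ ν = πs) ∧ MemLp id 2 πs ∧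
          ∀ (Ω : Type*) [MeasurableSpace Ω] (P : Measure Ω) [IsProbabilityMeasure P]
            (z₀ : Ω → Primal d × Dual m) (ξ : ℕ → Ω → Primal d),
            IsInput P z₀ ξ → MemLp z₀ 2 P →
            Tendsto (fun N => T 1 lam'⁻¹
              (P.map (iterates (modifiedStep f g K τ σ θ) z₀ ξ N)) πs) atTop (𝓝 0))) ∧
    -- the stationary distribution may differ from that of the unmodified algorithm
    (∀ (d m : ℕ) (K : Primal d →L[ℝ] Dual m) (τ σ θ ωg ωf : ℝ),
      0 < d → 0 < τ → 0 < σ → 0 < ωg → 0 < ωf →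
      max (1 + 2 * ωg * τ)⁻¹ (1 + 2 * ωf * σ)⁻¹ ≤ θ → θ < 1 → θ * σ * τ * ‖K‖ ^ 2 < 1 →
      ∃ (f : Dual m → EReal) (g : Primal d → EReal),
        IsPotential f ∧ IsPotential g ∧ IsStronglyConvex ωg g ∧ IsStronglyConvex ωf (conj f) ∧
        (∫⁻ x, EReal.exp (-(f (K x) + g x))) ≠ 0 ∧ (∫⁻ x, EReal.exp (-(f (K x) + g x))) ≠ ∞ ∧
        ∃ πorig πmod : Measure (Primal d × Dual m),
          (∀ ν, IsStationaryLaw (ulpdaStep f g K τ σ θ) ν ↔ ν = πorig) ∧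
          (∀ ν, IsStationaryLaw (modifiedStep f g K τ σ θ) ν ↔ ν = πmod) ∧
          πorig ≠ πmod) := by
  refine ⟨?_, ?_, ?_⟩
  · rintro d m K f g τ σ _ hf hg hτ hσ rfl hL Ω _ P _ z₀ z₀' ξ hz hz' π π' hπ hπ'
    obtain ⟨rfl, rfl⟩ := And.intro (funext hπ) (funext hπ')
    exact ⟨W2_map_fst_iterates_modifiedStep_le hf hg hτ hσ hL hz hz',
      fun hlt => T_iterates_modifiedStep_le hf hg hτ hσ hlt hz hz'⟩
  · rintro d m K f g τ σ θ ωg ωf _ _ hf hg hτ hσ hωg hωf hgs hfs hmax hθ hL rfl rfl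
    have h := admissible_of_max_le hτ hσ hωg hωf hmax hθ hL
    have hp := hg.isPrimalUpdate_modified hgs hτ
    rw [← weightRatio_eq, mul_right_comm θ τ σ]
    refine ⟨fun Ω _ P _ z₀ z₀' ξ hz hz' π π' hπ hπ' => ?_,
      fun hlt => h.exists_isStationaryLaw_tendsto hθ hlt hf hfs hp⟩
    obtain ⟨rfl, rfl⟩ := And.intro (funext hπ) (funext hπ')
    exact ⟨h.W2_map_fst_iterates_le hf hfs hp hz hz',
      fun hlt => h.T_iterates_le hlt hf hfs hp hz hz'⟩
  · intro d m K τ σ θ ωg ωf hd hτ hσ hωg hωf hmax hθ hlt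
    have h := admissible_of_max_le hτ hσ hωg hωf hmax hθ hlt.le
    have : Nonempty (Fin d) := ⟨⟨0, hd⟩⟩
    exact ⟨quadratic ωf⁻¹, quadratic ωg, isPotential_quadratic (inv_nonneg.mpr hωf.le),
      isPotential_quadratic hωg.le, isStronglyConvex_quadratic ωg,
      isStronglyConvex_conj_quadratic hωf, lintegral_exp_neg_quadratic_ne_zero ωg ωf⁻¹,
      lintegral_exp_neg_quadratic_ne_top hωg (inv_nonneg.mpr hωf.le),
      h.exists_isStationaryLaw_quadratic_ne hθ hlt hωg hωf⟩
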